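/- A \emph{tribe} is a category $\mathcal T$ with a class of morphisms called fibrations such that: $\mathcal T$ has a terminal object and every map to it is a fibration; isomorphisms are fibrations and fibrations are closed under composition; pullbacks of fibrations along arbitrary maps exist and are fibrations; every map factors as an anodyne map (one with the left lifting property against all fibrations) followed by a fibration; and pullbacks of anodyne maps along fibrations are anodyne. Weak equivalences in a tribe are the homotopy equivalences, where homotopies are maps into path objects (factorizations $B\to PB\to B\times B$ of the diagonal into an anodyne map followed by a fibration). A category is \emph{direct} if it has a degree function on objects with values in $\mathbb N$ that is strictly raised by every non-identity arrow, and \emph{generalized direct} if it has such a function that is preserved by isomorphisms and strictly raised by every non-invertible arrow. Let $R$ be a generalized direct category, $R_0$ a direct category and $c:R_0\to R$ a functor that reflects isomorphisms (so $c(k)$ is invertible only if $k$ is an identity) and lifts arrows up to isomorphism: for each $f:a\to b$ in $R$ there are $k:x\to y$ in $R_0$ and isomorphisms $w:a\cong c(x)$, $w':b\cong c(y)$ with $w'f=c(k)w$. Let $\mathbf F$ be the free category comonad on categories and let $\mathbf F_\simeq(R)$ be the pushout of $R_0\leftarrow\mathbf F(R_0)\to\mathbf F(R)$; it has a functor $p_0$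 to $R$ that composes paths. In the twisted arrow category of $\mathbf F_\simeq(R)$ a morphism from $f:a\to b$ to $g:a'\to b'$ is a pair $(u:a'\to a,\ v:b\to b')$ with $vfu=g$. Let $\mathbf D_R$ be its full subcategory on the arrows of the form $x\to z\to y$, where $x\to z$ comes from an arrow of $R_0$ and $z\to y$ is an identity or the class of a path of length one consisting of an isomorphism of $R$. Let $p:\mathbf D_R\to R$ be the target functor followed by $p_0$. For $X:\mathbf D_R^{op}\to\mathcal T$, the matching object $M_dX$ is the limit of $X$ over the non-identity arrows $e\to d$. A morphism $m:X\to Y$ is a Reedy fibration if, for every $d$, the matching objects and the pullback $M_dX\times_{M_dY}Y_d$ exist and $X_d\to M_dX\times_{M_dY}Y_d$ is a fibration; $X$ is Reedy fibrant if, for every $d$, $M_dX$ exists and $X_d\to M_dX$ is a fibration. A morphism $m$ of diagrams $R^{op}\to\mathcal T$ is a \emph{$p$-fibration} if $p^*m$ is a Reedy fibration, and a diagram $F$ is \emph{$p$-fibrant} if $p^*F$ is Reedy fibrant. Let $R\text{-Fr}(\mathcal T)$ be the full subcategory of $\mathcal T^{R^{op}}$ on the $p$-fibrant diagrams that send every arrow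 of $R$ to a weak equivalence. \textbf{Theorem.} For every tribe $\mathcal T$, the category $R\text{-Fr}(\mathcal T)$, with the $p$-fibrations as its fibrations, is a tribe. -/

import Mathlib

open CategoryTheory CategoryTheory.Limits Opposite

universe v v' u u'

/-! ### Tribes -/

/-- The class `fib` of fibrations makes `C` a tribe. An anodyne morphism is one with the left
lifting property against all fibrations, that is, a member of `fib.llp`. -/
structure IsTribe {C : Type u} [Category.{v} C] (fib : MorphismProperty C) : Prop where
  hasTerminal : HasTerminal C
  fib_toTerminal : ∀ {X Z : C} (hZ : IsTerminal Z), fib (hZ.from X)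
  fib_of_isIso : ∀ {X Y : C} (f : X ⟶ Y), IsIso f → fib f
  fib_comp : ∀ {X Y Z : C} (f : X ⟶ Y) (g : Y ⟶ Z), fib f → fib g → fib (f ≫ g)
  hasPullback : ∀ {X Y S : C} (f : X ⟶ S) (p : Y ⟶ S), fib p → HasPullback f p
  fib_baseChange : ∀ {P X Y S : C} {p' : P ⟶ X} {f' : P ⟶ Y} {f : X ⟶ S} {p : Y ⟶ S},
    IsPullback p' f' f p → fib p → fib p'
  factorization : ∀ {X Y : C} (f : X ⟶ Y),
    ∃ (Z : C) (i : X ⟶ Z) (p : Z ⟶ Y), fib.llp i ∧ fib p ∧ i ≫ p = f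
  anodyne_baseChange : ∀ {P X Y S : C} {i' : P ⟶ X} {q' : P ⟶ Y} {q : X ⟶ S} {i : Y ⟶ S},
    IsPullback i' q' q i → fib q → fib.llp i → fib.llp i'

section Homotopy

variable {C : Type u} [Category.{v} C] (fib : MorphismProperty C)

/-- Two parallel morphisms are homotopic if they are jointly the composite of a morphism to a path
object of the target with its two projections. A path object of `B` is a factorization
`B ⟶ P ⟶ B × B` of the diagonal into an anodyne morphism followed by a fibration. -/
def TribeHomotopic {A B : C} (f g : A ⟶ B) : Prop :=
  ∃ (b : BinaryFan B B) (hb : IsLimit b) (P : C) (s : B ⟶ P) (d₀ d₁ : P ⟶ B),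
    fib.llp s ∧ fib (hb.lift (BinaryFan.mk d₀ d₁)) ∧ s ≫ d₀ = 𝟙 B ∧ s ≫ d₁ = 𝟙 B ∧
      ∃ h : A ⟶ P, h ≫ d₀ = f ∧ h ≫ d₁ = g

/-- The weak equivalences of a tribe: the homotopy equivalences. -/
def IsTribeWeakEquivalence {A B : C} (f : A ⟶ B) : Prop :=
  ∃ g : B ⟶ A, TribeHomotopic fib (f ≫ g) (𝟙 A) ∧ TribeHomotopic fib (g ≫ f) (𝟙 B)

end Homotopy

/-! ### Direct and generalized direct categories -/

/-- A direct category: non-identity arrows strictly raise a degree with values in `ℕ`. -/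
def IsDirectCategory (C : Type u) [Category.{v} C] : Prop :=
  ∃ deg : C → ℕ, ∀ ⦃x y : C⦄ (f : x ⟶ y),
    ¬ MorphismProperty.identities C f → deg x < deg y

/-- A generalized direct category: isomorphisms preserve a degree with values in `ℕ`, and
non-invertible arrows strictly raise it. -/
def IsGeneralizedDirectCategory (C : Type u) [Category.{v} C] : Prop :=
  ∃ deg : C → ℕ, ∀ ⦃x y : C⦄ (f : x ⟶ y),
    (IsIso f → deg x = deg y) ∧ (¬ IsIso f → deg x < deg y)

/-- Every arrow of `R` is, up to isomorphisms of its source and target, the image of an arrow. -/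
def LiftsArrowsUpToIso {R₀ : Type u} [Category.{v} R₀] {R : Type u'} [Category.{v'} R]
    (c : R₀ ⥤ R) : Prop :=
  ∀ ⦃a b : R⦄ (f : a ⟶ b), ∃ (x y : R₀) (k : x ⟶ y) (w : a ≅ c.obj x) (w' : b ≅ c.obj y),
    f ≫ w'.hom = w.hom ≫ c.map k

/-! ### Reedy fibrations over the opposite of a direct category -/

section Reedy

variable {D : Type u} [Category.{v} D] {T : Type u'} [Category.{v'} T]

/-- The objects of the latching category of `d`: the non-identity arrows with target `d`. -/
def latchingProperty (d : D) : ObjectProperty (Over d) :=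
  fun e => ¬ MorphismProperty.identities D e.hom

/-- The diagram whose limit is the matching object of `X` at `d`. -/
def matchingDiagram (X : Dᵒᵖ ⥤ T) (d : D) : (latchingProperty d).FullSubcategoryᵒᵖ ⥤ T :=
  ((latchingProperty d).ι ⋙ Over.forget d).op ⋙ X

/-- The canonical cone with vertex `X d`, which induces the matching map of `X` at `d`. -/
def matchingCone (X : Dᵒᵖ ⥤ T) (d : D) : Cone (matchingDiagram X d) where
  pt := X.obj (op d)
  π :=
    { app := fun e => X.map e.unop.obj.hom.op
      naturality := fun e _ f => (Category.id_comp _).trans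
        ((congrArg (fun t => X.map (Quiver.Hom.op t)) (Over.w f.unop.hom).symm).trans
          (X.map_comp e.unop.obj.hom.op f.unop.hom.left.op)) }

/-- The natural transformation between matching diagrams induced by `m`. -/
def matchingDiagramMap {X Y : Dᵒᵖ ⥤ T} (m : X ⟶ Y) (d : D) :
    matchingDiagram X d ⟶ matchingDiagram Y d :=
  Functor.whiskerLeft ((latchingProperty d).ι ⋙ Over.forget d).op m

/-- `X` is Reedy fibrant: the matching objects exist and the matching maps are fibrations. -/
def IsReedyFibrant (fib : MorphismProperty T) (X : Dᵒᵖ ⥤ T) : Prop :=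
  ∀ d : D, ∃ (M : Cone (matchingDiagram X d)) (hM : IsLimit M),
    fib (hM.lift (matchingCone X d))

/-- `m : X ⟶ Y` is a Reedy fibration: for every `d`, the relative matching map
`X d ⟶ M_d X ×_{M_d Y} Y d` exists and is a fibration. -/
def IsReedyFibration (fib : MorphismProperty T) {X Y : Dᵒᵖ ⥤ T} (m : X ⟶ Y) : Prop :=
  ∀ d : D, ∃ (M : Cone (matchingDiagram X d)) (hM : IsLimit M)
    (N : Cone (matchingDiagram Y d)) (hN : IsLimit N)
    (P : T) (a : P ⟶ M.pt) (b : P ⟶ Y.obj (op d)) (l : X.obj (op d) ⟶ P),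
      IsPullback a b (hN.map M (matchingDiagramMap m d)) (hN.lift (matchingCone Y d)) ∧
      l ≫ a = hM.lift (matchingCone X d) ∧ l ≫ b = m.app (op d) ∧ fib l

end Reedy

/-! ### Twisted arrow categories -/

/-- Objects of the twisted arrow category of `C`: the arrows of `C`. -/
structure TwistedArrow (C : Type u) [Category.{v} C] where
  /-- the source of the arrow -/
  dom : C
  /-- the target of the arrow -/
  cod : C
  /-- the arrow -/
  arr : dom ⟶ cod

/-- A morphism from `f` to `g` in the twisted arrow category: a factorization of `g` through `f`,
contravariant on sources and covariant on targets. -/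
@[ext]
structure TwistedArrow.Hom {C : Type u} [Category.{v} C] (f g : TwistedArrow C) where
  /-- the map on sources -/
  left : g.dom ⟶ f.dom
  /-- the map on targets -/
  right : f.cod ⟶ g.cod
  /-- the factorization -/
  w : left ≫ f.arr ≫ right = g.arr

instance {C : Type u} [Category.{v} C] : Category (TwistedArrow C) where
  Hom := TwistedArrow.Hom
  id f := ⟨𝟙 _, 𝟙 _, by simp⟩
  comp {f g h} a b := ⟨b.left ≫ a.left, a.right ≫ b.right, by
    rw [← b.w, ← a.w]; simp only [Category.assoc]⟩
  id_comp a := TwistedArrow.Hom.ext (Category.comp_id _) (Category.id_comp _)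
  comp_id a := TwistedArrow.Hom.ext (Category.id_comp _) (Category.comp_id _)
  assoc a b c := TwistedArrow.Hom.ext (Category.assoc _ _ _).symm (Category.assoc _ _ _)

/-- The target functor on the twisted arrow category. -/
def TwistedArrow.target (C : Type u) [Category.{v} C] : TwistedArrow C ⥤ C where
  obj f := f.cod
  map a := a.right
  map_id _ := rfl
  map_comp _ _ := rfl

/-! ### The category `D_R` -/

section DR

variable {R₀ : Type u} [Category.{v} R₀] {R : Type u'} [Category.{v'} R] (c : R₀ ⥤ R)

/-- The relations imposed on the free category on `R`: composites and identities of arrows that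
come from `R₀` are computed in `R₀`. -/
inductive FreeIsoRel : HomRel (Paths R)
  | id (x : R₀) :
      FreeIsoRel ((Paths.of R).map (c.map (𝟙 x))) (𝟙 ((Paths.of R).obj (c.obj x)))
  | comp {x y z : R₀} (k : x ⟶ y) (l : y ⟶ z) :
      FreeIsoRel ((Paths.of R).map (c.map (k ≫ l)))
        ((Paths.of R).map (c.map k) ≫ (Paths.of R).map (c.map l))

/-- The pushout of `R₀ ← F(R₀) → F(R)`, where `F` is the free category comonad on categories. Since
`F(R₀) → R₀` is bijective on objects and full, it is the quotient of `F(R)` by `FreeIsoRel c`. -/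
abbrev FreeIsoCat : Type u' := CategoryTheory.Quotient (FreeIsoRel c)

/-- The pushout leg `F(R) → F_≃(R)`. -/
def FreeIsoCat.ofFree : Paths R ⥤ FreeIsoCat c := CategoryTheory.Quotient.functor (FreeIsoRel c)

/-- The pushout leg `R₀ → F_≃(R)`. -/
def FreeIsoCat.ofDirect : R₀ ⥤ FreeIsoCat c where
  obj x := (FreeIsoCat.ofFree c).obj ((Paths.of R).obj (c.obj x))
  map k := (FreeIsoCat.ofFree c).map ((Paths.of R).map (c.map k))
  map_id x := (CategoryTheory.Quotient.sound _ (FreeIsoRel.id x)).trans ((FreeIsoCat.ofFree c).map_id _)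
  map_comp k l := (CategoryTheory.Quotient.sound _ (FreeIsoRel.comp k l)).trans ((FreeIsoCat.ofFree c).map_comp _ _)

/-- The functor `p₀ : F_≃(R) → R` composing the paths in `R`. -/
def FreeIsoCat.toBase : FreeIsoCat c ⥤ R :=
  CategoryTheory.Quotient.lift (FreeIsoRel c) (pathComposition R) (by
    rintro _ _ _ _ (x | ⟨k, l⟩)
    · exact (composePath_toPath _).trans (c.map_id x)
    · refine (composePath_toPath _).trans ((c.map_comp k l).trans ?_)
      rw [Functor.map_comp]
      exact congrArg₂ _ (composePath_toPath _).symm (composePath_toPath _).symm)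

/-- The objects of `D_R`: the arrows `x ⟶ z ⟶ y` of `F_≃(R)` in which `x ⟶ z` comes from `R₀` and
`z ⟶ y` is an identity or a free isomorphism (a path of length one on an isomorphism of `R`). -/
inductive IsDRObject : ObjectProperty (TwistedArrow (FreeIsoCat c))
  | ofDirect {x z : R₀} (k : x ⟶ z) :
      IsDRObject ⟨_, _, (FreeIsoCat.ofDirect c).map k⟩
  | ofDirectIso {x z : R₀} {y : R} (k : x ⟶ z) (w : c.obj z ≅ y) :
      IsDRObject ⟨_, _, (FreeIsoCat.ofDirect c).map k ≫
        (FreeIsoCat.ofFree c).map ((Paths.of R).map w.hom)⟩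

/-- The category `D_R`, a full subcategory of the twisted arrow category of `F_≃(R)`. -/
abbrev DR : Type _ := (IsDRObject c).FullSubcategory

/-- The projection `p : D_R → R`, sending an arrow to (the image in `R` of) its target. -/
def DR.proj : DR c ⥤ R :=
  (IsDRObject c).ι ⋙ TwistedArrow.target (FreeIsoCat c) ⋙ FreeIsoCat.toBase c

end DR

/-! ### Frames -/

section Frames

variable {R₀ : Type*} [Category* R₀] {R : Type*} [Category* R] (c : R₀ ⥤ R)
  {T : Type*} [Category* T] (fib : MorphismProperty T)

/-- The `p`-fibrations: the morphisms of diagrams whose restriction along `p` is a Reedy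
fibration. -/
def pFibrations : MorphismProperty (Rᵒᵖ ⥤ T) :=
  fun _ _ m => IsReedyFibration fib (Functor.whiskerLeft (DR.proj c).op m)

/-- The `R`-frames in `T`: the diagrams whose restriction along `p` is Reedy fibrant and which send
every arrow to a weak equivalence. -/
def IsFrame : ObjectProperty (Rᵒᵖ ⥤ T) :=
  fun F => IsReedyFibrant fib ((DR.proj c).op ⋙ F) ∧
    ∀ ⦃x y : Rᵒᵖ⦄ (f : x ⟶ y), IsTribeWeakEquivalence fib (F.map f)

/-- The category of `R`-frames in `T`, a full subcategory of the category of diagrams. -/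
abbrev FrameCat : Type _ := (IsFrame c fib).FullSubcategory

/-- The fibrations between `R`-frames: the `p`-fibrations. -/
def frameFibrations : MorphismProperty (FrameCat c fib) :=
  (pFibrations c fib).inverseImage (IsFrame c fib).ι

end Frames

/-!
A map to a discrete object, that is, one whose diagonal is a fibration, has a graph which is a
fibration (`IsTribeDiscrete.fib_graph`), so it is itself a fibration, and two maps to a discrete
object that agree on the source of an anodyne map are equal. The theorem holds because, over `D_R`,
the Reedy condition on a homotopical diagram only says that certain values are discrete.

Let `F` be a diagram on `Rᵒᵖ` and let `d : x ⟶ y` be an arrow in `D_R`; call the objects of `F_≃(R)`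
that come from `R₀` vertices. The matching object of `p^* F` at `d` is
* terminal if `d` is an identity (`DR.nonempty_isLimit_of_isTerminal`);
* `F(y)` if `y` is not a vertex, or if `d` is a composite of two arrows that are not identities
  (`DR.nonempty_isLimit_of_not_isVertex`, `DR.nonempty_isLimit_of_decomposable`);
* `F(x) × F(y)` otherwise, the matching map being the graph of `F(y) ⟶ F(x)`
  (`DR.exists_matching_of_indecomposable`).

These computations rest on two properties of words in `F_≃(R)`: there is an additive length that
vanishes exactly on identities (`FreeIsoCat.exists_length`), and a last letter that does not come
from `R₀` can be cancelled (`FreeIsoCat.cancel_letter`).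

If `F` sends all arrows to weak equivalences and the graph of `F(y) ⟶ F(x)` is a fibration, then
`F(x)` is discrete (`IsTribeDiscrete.of_fib_graph`). Call an object of `R` special if it is
isomorphic to the source of an indecomposable arrow between vertices in `D_R`. The frames are
therefore the homotopical diagrams whose values at special objects are discrete
(`IsFrame.isTribeDiscrete`, `isFrame_of_isTribeDiscrete`), and since all matching maps except those
at identities are monomorphisms, the `p`-fibrations between frames are the levelwise fibrations
(`pFibrations_iff`).

Every arrow of `R` out of an object that is not special is the unique isomorphism to its target. So
a restriction map of a frame is invertible or has a discrete target, and all constructions can be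
made levelwise: for base changes, the only point is that they preserve homotopical diagrams
(`IsTribe.weakEquivalence_pullback`); for lifts and factorizations, naturality and functoriality at
special objects follow from the uniqueness of extensions along anodyne maps to discrete objects, and
at other objects everything is transported from a representative of the isomorphism class
(`exists_lift_functor`, `exists_factorization_functor`).
-/

/-! ### Tribes: anodyne maps, path objects and fibrations -/

section Tribe

attribute [local simp] prod.lift_fst prod.lift_snd prod.lift_fst_assoc prod.lift_snd_assoc

variable {T : Type u} [Category.{v} T] {fib : MorphismProperty T}

lemma CategoryTheory.MorphismProperty.llp.exists_lift {A B X Y : T} {i : A ⟶ B} {p : X ⟶ Y}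
    (hi : fib.llp i) (hp : fib p) (a : A ⟶ X) (b : B ⟶ Y) (w : a ≫ p = i ≫ b) :
    ∃ l : B ⟶ X, i ≫ l = a ∧ l ≫ p = b := by
  have := hi p hp
  have sq : CommSq a i p b := ⟨w⟩
  exact ⟨sq.lift, sq.fac_left, sq.fac_right⟩

namespace IsTribe

lemma exists_isPullback (hT : IsTribe fib) {X Y S : T} (f : X ⟶ S) (p : Y ⟶ S) (hp : fib p) :
    ∃ (P : T) (p' : P ⟶ X) (f' : P ⟶ Y), IsPullback p' f' f p := by
  have := hT.hasPullback f p hp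
  exact ⟨_, _, _, IsPullback.of_hasPullback f p⟩

lemma fib_terminalFrom (hT : IsTribe fib) [HasTerminal T] (X : T) : fib (terminal.from X) :=
  hT.fib_toTerminal terminalIsTerminal

lemma hasBinaryProducts (hT : IsTribe fib) : HasBinaryProducts T := by
  have := hT.hasTerminal
  have (X Y : T) : HasLimit (pair X Y) :=
    have := hT.hasPullback (terminal.from X) (terminal.from Y) (hT.fib_terminalFrom Y)
    ⟨⟨_, isProductOfIsTerminalIsPullback _ _ _ _ terminalIsTerminal
      (IsPullback.of_hasPullback (terminal.from X) (terminal.from Y)).isLimit⟩⟩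
  exact hasBinaryProducts_of_hasLimit_pair T

/-- A map `k` whose composite with a monomorphism `j` is a fibration is itself a fibration, being
the base change of `k ≫ j` along `j`. -/
lemma fib_of_mono (hT : IsTribe fib) {E W V : T} (k : E ⟶ W) (j : W ⟶ V) [Mono j]
    (h : fib (k ≫ j)) : fib k := by
  refine hT.fib_baseChange (p' := k) (f' := 𝟙 E) (f := j) (p := k ≫ j) ?_ h
  refine ⟨⟨by simp⟩, ⟨PullbackCone.IsLimit.mk _ (fun s => s.snd) (fun s => ?_)
    (fun s => by simp) (fun s m _ h₂ => by simpa using h₂)⟩⟩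
  rw [← cancel_mono j, Category.assoc, ← s.condition]

/-- Let `g : Y ⟶ S` have an anodyne section `s`. The induced section of the base change of `g`
along a fibration `f` is anodyne, being the base change of `s` along a fibration. -/
lemma anodyne_baseChange_section (hT : IsTribe fib) {W X Y S : T} {a : W ⟶ X} {b : W ⟶ Y}
    {f : X ⟶ S} {g : Y ⟶ S} (sq : IsPullback a b f g) (hf : fib f) {s : S ⟶ Y}
    (hs : fib.llp s) (hsg : s ≫ g = 𝟙 S) {i : X ⟶ W} (hia : i ≫ a = 𝟙 X) (hib : i ≫ b = f ≫ s) :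
    fib.llp i := by
  have hb : fib b := hT.fib_baseChange sq.flip hf
  refine hT.anodyne_baseChange (i' := i) (q' := f) (q := b) (i := s) ?_ hb hs
  refine IsPullback.of_right (h₁₂ := a) (v₁₃ := f) (h₂₂ := g) ?_ hib sq
  rw [hia, hsg]
  exact IsPullback.id_horiz f

lemma homotopic_comp_left {A A' B : T} (e : A' ⟶ A) {f g : A ⟶ B}
    (H : TribeHomotopic fib f g) : TribeHomotopic fib (e ≫ f) (e ≫ g) := by
  obtain ⟨b, hb, P, s, d₀, d₁, hs, hd, h₀, h₁, h, rfl, rfl⟩ := H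
  exact ⟨b, hb, P, s, d₀, d₁, hs, hd, h₀, h₁, e ≫ h, by simp, by simp⟩

variable [HasBinaryProducts T]

lemma exists_pathObject (hT : IsTribe fib) (B : T) :
    ∃ (P : T) (s : B ⟶ P) (d : P ⟶ B ⨯ B), fib.llp s ∧ fib d ∧ s ≫ d = diag B :=
  hT.factorization (diag B)

lemma homotopic_of_pathObject {A B P : T} {f g : A ⟶ B} {s : B ⟶ P} {d : P ⟶ B ⨯ B}
    (hs : fib.llp s) (hd : fib d) (hsd : s ≫ d = diag B) (h : A ⟶ P)
    (hh : h ≫ d = prod.lift f g) : TribeHomotopic fib f g := by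
  refine ⟨BinaryFan.mk prod.fst prod.snd, prodIsProd B B, P, s, d ≫ prod.fst, d ≫ prod.snd,
    hs, ?_, ?_, ?_, h, ?_, ?_⟩
  · convert! hd
    refine BinaryFan.IsLimit.hom_ext (prodIsProd B B) ?_ ?_
    · exact (prodIsProd B B).fac _ ⟨WalkingPair.left⟩
    · exact (prodIsProd B B).fac _ ⟨WalkingPair.right⟩
  · simp [reassoc_of% hsd]
  · simp [reassoc_of% hsd]
  · simp [reassoc_of% hh]
  · simp [reassoc_of% hh]

/-- A homotopy can be represented in any path object. -/
lemma _root_.TribeHomotopic.exists_lift {A B P : T} {f g : A ⟶ B} (H : TribeHomotopic fib f g)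
    {s : B ⟶ P} {d : P ⟶ B ⨯ B} (hd : fib d) (hsd : s ≫ d = diag B) :
    ∃ h : A ⟶ P, h ≫ d = prod.lift f g := by
  obtain ⟨b, hb, P', s', d₀, d₁, hs', -, h₀, h₁, h, rfl, rfl⟩ := H
  obtain ⟨l, -, hl⟩ := hs'.exists_lift hd s (prod.lift d₀ d₁) (by
    rw [hsd]; ext <;> simp [h₀, h₁])
  exact ⟨h ≫ l, by rw [Category.assoc, hl]; ext <;> simp⟩

lemma fib_fst (hT : IsTribe fib) (X Y : T) : fib (prod.fst : X ⨯ Y ⟶ X) :=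
  have := hT.hasTerminal
  hT.fib_baseChange (IsPullback.of_hasBinaryProduct' X Y) (hT.fib_terminalFrom Y)

lemma fib_snd (hT : IsTribe fib) (X Y : T) : fib (prod.snd : X ⨯ Y ⟶ Y) :=
  have := hT.hasTerminal
  hT.fib_baseChange (IsPullback.of_hasBinaryProduct' X Y).flip (hT.fib_terminalFrom X)

lemma homotopic_refl (hT : IsTribe fib) {A B : T} (f : A ⟶ B) : TribeHomotopic fib f f := by
  obtain ⟨P, s, d, hs, hd, hsd⟩ := hT.exists_pathObject B
  exact homotopic_of_pathObject hs hd hsd (f ≫ s) (by rw [Category.assoc, hsd]; ext <;> simp)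

lemma homotopic_symm (hT : IsTribe fib) {A B : T} {f g : A ⟶ B} (H : TribeHomotopic fib f g) :
    TribeHomotopic fib g f := by
  obtain ⟨P, s, d, hs, hd, hsd⟩ := hT.exists_pathObject B
  obtain ⟨h, hh⟩ := H.exists_lift hd hsd
  refine homotopic_of_pathObject (d := d ≫ (prod.braiding B B).hom) hs
    (hT.fib_comp _ _ hd (hT.fib_of_isIso _ inferInstance)) ?_ h ?_
  · rw [reassoc_of% hsd]; ext <;> simp
  · rw [reassoc_of% hh]; ext <;> simp

/-- Homotopies are composed in the pullback `P ×_B P` of a path object: the map from `B` to it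
is anodyne, so that `P ×_B P` maps to `P` over `B × B`. -/
lemma homotopic_trans (hT : IsTribe fib) {A B : T} {f g k : A ⟶ B} (H : TribeHomotopic fib f g)
    (K : TribeHomotopic fib g k) : TribeHomotopic fib f k := by
  obtain ⟨P, s, d, hs, hd, hsd⟩ := hT.exists_pathObject B
  obtain ⟨h, hh⟩ := H.exists_lift hd hsd
  obtain ⟨h', hh'⟩ := K.exists_lift hd hsd
  have hd₀ : fib (d ≫ prod.fst) := hT.fib_comp _ _ hd (hT.fib_fst B B)
  have hd₁ : fib (d ≫ prod.snd) := hT.fib_comp _ _ hd (hT.fib_snd B B)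
  have hs₀ : s ≫ d ≫ prod.fst = 𝟙 B := by simp [reassoc_of% hsd]
  have hs₁ : s ≫ d ≫ prod.snd = 𝟙 B := by simp [reassoc_of% hsd]
  obtain ⟨W, a, b, sq⟩ := hT.exists_isPullback (d ≫ prod.snd) (d ≫ prod.fst) hd₀
  have hi : fib.llp (sq.lift (𝟙 P) ((d ≫ prod.snd) ≫ s) (by simp [hs₀])) :=
    hT.anodyne_baseChange_section sq hd₁ hs hs₀ (by simp) (by simp)
  have hj := fib.llp.comp_mem _ _ hs hi
  obtain ⟨l, -, hl⟩ := hj.exists_lift hd s (prod.lift (a ≫ d ≫ prod.fst) (b ≫ d ≫ prod.snd)) (by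
    ext
    · simp [hs₀]
    · simp only [Category.assoc, prod.lift_snd, IsPullback.lift_snd_assoc, hs₁]
      simp [hs₁])
  refine homotopic_of_pathObject hs hd hsd
    (sq.lift h h' (by simp [reassoc_of% hh, reassoc_of% hh']) ≫ l) ?_
  rw [Category.assoc, hl]
  ext
  · simp [reassoc_of% hh]
  · simp [reassoc_of% hh']

lemma homotopic_comp_right (hT : IsTribe fib) {A B C : T} {f g : A ⟶ B} (k : B ⟶ C)
    (H : TribeHomotopic fib f g) : TribeHomotopic fib (f ≫ k) (g ≫ k) := by
  obtain ⟨P, s, d, hs, hd, hsd⟩ := hT.exists_pathObject B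
  obtain ⟨P', s', d', hs', hd', hsd'⟩ := hT.exists_pathObject C
  obtain ⟨h, hh⟩ := H.exists_lift hd hsd
  obtain ⟨l, -, hl⟩ := hs.exists_lift hd' (k ≫ s') (d ≫ prod.map k k) (by
    rw [reassoc_of% hsd, Category.assoc, hsd']; ext <;> simp)
  refine homotopic_of_pathObject hs' hd' hsd' (h ≫ l) ?_
  rw [Category.assoc, hl, reassoc_of% hh]
  ext <;> simp

end IsTribe

/-! ### Weak equivalences in a tribe -/

/-- Homotopy, as a relation on the morphisms of a tribe. -/
def homotopyRel (fib : MorphismProperty T) : HomRel T := fun _ _ f g => TribeHomotopic fib f g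

namespace IsTribe

lemma congruence_homotopyRel (hT : IsTribe fib) : Congruence (homotopyRel fib) := by
  have := hT.hasBinaryProducts
  exact
  { equivalence := ⟨hT.homotopic_refl, hT.homotopic_symm, hT.homotopic_trans⟩
    comp_left := fun e _ _ h => homotopic_comp_left e h
    comp_right := fun k h => hT.homotopic_comp_right k h }

/-- The weak equivalences are the morphisms that become invertible in the homotopy category, which
is why they satisfy two-out-of-three. -/
lemma weakEquivalence_iff_isIso (hT : IsTribe fib) {A B : T} (f : A ⟶ B) :
    IsTribeWeakEquivalence fib f ↔
      IsIso ((CategoryTheory.Quotient.functor (homotopyRel fib)).map f) := by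
  have := hT.congruence_homotopyRel
  constructor
  · rintro ⟨g, h₁, h₂⟩
    refine ⟨(CategoryTheory.Quotient.functor (homotopyRel fib)).map g, ?_, ?_⟩
    · rw [← Functor.map_comp, ← CategoryTheory.Functor.map_id]
      exact (CategoryTheory.Quotient.functor_map_eq_iff (homotopyRel fib) _ _).2 h₁
    · rw [← Functor.map_comp, ← CategoryTheory.Functor.map_id]
      exact (CategoryTheory.Quotient.functor_map_eq_iff (homotopyRel fib) _ _).2 h₂
  · rintro ⟨g, h₁, h₂⟩
    obtain ⟨g, rfl⟩ := (CategoryTheory.Quotient.functor (homotopyRel fib)).map_surjective g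
    rw [← Functor.map_comp, ← CategoryTheory.Functor.map_id] at h₁ h₂
    exact ⟨g, (CategoryTheory.Quotient.functor_map_eq_iff (homotopyRel fib) _ _).1 h₁,
      (CategoryTheory.Quotient.functor_map_eq_iff (homotopyRel fib) _ _).1 h₂⟩

lemma weakEquivalence_of_isIso (hT : IsTribe fib) {A B : T} (f : A ⟶ B) [IsIso f] :
    IsTribeWeakEquivalence fib f := by
  rw [hT.weakEquivalence_iff_isIso]; infer_instance

lemma weakEquivalence_comp (hT : IsTribe fib) {A B C : T} {f : A ⟶ B} {g : B ⟶ C}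
    (hf : IsTribeWeakEquivalence fib f) (hg : IsTribeWeakEquivalence fib g) :
    IsTribeWeakEquivalence fib (f ≫ g) := by
  rw [hT.weakEquivalence_iff_isIso] at *
  rw [Functor.map_comp]; infer_instance

lemma weakEquivalence_of_comp_left (hT : IsTribe fib) {A B C : T} {f : A ⟶ B} {g : B ⟶ C}
    (hf : IsTribeWeakEquivalence fib f) (hfg : IsTribeWeakEquivalence fib (f ≫ g)) :
    IsTribeWeakEquivalence fib g := by
  rw [hT.weakEquivalence_iff_isIso] at *
  rw [Functor.map_comp] at hfg
  exact IsIso.of_isIso_comp_left ((CategoryTheory.Quotient.functor (homotopyRel fib)).map f)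
    ((CategoryTheory.Quotient.functor (homotopyRel fib)).map g)

lemma weakEquivalence_of_comp_right (hT : IsTribe fib) {A B C : T} {f : A ⟶ B} {g : B ⟶ C}
    (hg : IsTribeWeakEquivalence fib g) (hfg : IsTribeWeakEquivalence fib (f ≫ g)) :
    IsTribeWeakEquivalence fib f := by
  rw [hT.weakEquivalence_iff_isIso] at *
  rw [Functor.map_comp] at hfg
  exact IsIso.of_isIso_comp_right ((CategoryTheory.Quotient.functor (homotopyRel fib)).map f)
    ((CategoryTheory.Quotient.functor (homotopyRel fib)).map g)

variable [HasBinaryProducts T]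

lemma weakEquivalence_of_anodyne (hT : IsTribe fib) {A B : T} {i : A ⟶ B} (hi : fib.llp i) :
    IsTribeWeakEquivalence fib i := by
  have := hT.hasTerminal
  obtain ⟨r, hr, -⟩ := hi.exists_lift (hT.fib_terminalFrom A) (𝟙 A) (terminal.from B)
    (Subsingleton.elim _ _)
  obtain ⟨P, s, d, hs, hd, hsd⟩ := hT.exists_pathObject B
  obtain ⟨h, -, hh⟩ := hi.exists_lift hd (i ≫ s) (prod.lift (r ≫ i) (𝟙 B)) (by
    rw [Category.assoc, hsd]; ext <;> simp [reassoc_of% hr])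
  exact ⟨r, by rw [hr]; exact hT.homotopic_refl _, homotopic_of_pathObject hs hd hsd h hh⟩

/-- Homotopies lift along fibrations: the map from `E` to the object of pairs of a point of `E` and a
path of `B` starting at its image is anodyne, so that paths can be lifted to `E`. -/
lemma homotopy_lifting (hT : IsTribe fib) {A E B : T} {p : E ⟶ B} (hp : fib p) (e : A ⟶ E)
    {w : A ⟶ B} (H : TribeHomotopic fib (e ≫ p) w) :
    ∃ e' : A ⟶ E, e' ≫ p = w ∧ TribeHomotopic fib e e' := by
  obtain ⟨P, s, d, hs, hd, hsd⟩ := hT.exists_pathObject B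
  obtain ⟨P', s', d', hs', hd', hsd'⟩ := hT.exists_pathObject E
  obtain ⟨h, hh⟩ := H.exists_lift hd hsd
  have hs₀ : s ≫ d ≫ prod.fst = 𝟙 B := by simp [reassoc_of% hsd]
  have hs₁ : s ≫ d ≫ prod.snd = 𝟙 B := by simp [reassoc_of% hsd]
  obtain ⟨W, a, b, sq⟩ := hT.exists_isPullback p (d ≫ prod.fst)
    (hT.fib_comp _ _ hd (hT.fib_fst B B))
  have hi : fib.llp (sq.lift (𝟙 E) (p ≫ s) (by simp [hs₀])) :=
    hT.anodyne_baseChange_section sq hp hs hs₀ (by simp) (by simp)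
  -- `t` transports a point of `E` along a path of `B` starting at its image
  obtain ⟨t, ht, htp⟩ := hi.exists_lift hp (𝟙 E) (b ≫ d ≫ prod.snd) (by
    rw [IsPullback.lift_snd_assoc]; simp [hs₁])
  obtain ⟨k, -, hk⟩ := hi.exists_lift hd' s' (prod.lift a t) (by
    rw [hsd']; ext <;> simp [ht])
  have w₀ : e ≫ p = h ≫ d ≫ prod.fst := by simp [reassoc_of% hh]
  refine ⟨sq.lift e h w₀ ≫ t, ?_, homotopic_of_pathObject hs' hd' hsd' (sq.lift e h w₀ ≫ k) ?_⟩
  · rw [Category.assoc, htp, IsPullback.lift_snd_assoc]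
    simp [reassoc_of% hh]
  · rw [Category.assoc, hk]; ext <;> simp

/-- Trivial fibrations are stable under base change along fibrations: a strict section is obtained
by lifting homotopies along `f`, and the homotopy that makes it an inverse is moved into the
fibres by lifting it along `u'`. -/
lemma weakEquivalence_baseChange_fib (hT : IsTribe fib) {E' E A B : T} {f' : E' ⟶ A}
    {u' : E' ⟶ E} {u : A ⟶ B} {f : E ⟶ B} (sq : IsPullback f' u' u f) (hf : fib f)
    (hw : IsTribeWeakEquivalence fib f) (hu : fib u) : IsTribeWeakEquivalence fib f' := by
  obtain ⟨g, hg₁, hg₂⟩ := hw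
  obtain ⟨s, hs, hgs⟩ := hT.homotopy_lifting hf g hg₂
  have hfs : TribeHomotopic fib (f ≫ s) (𝟙 E) :=
    hT.homotopic_trans (homotopic_comp_left f (hT.homotopic_symm hgs)) hg₁
  have hu' : fib u' := hT.fib_baseChange sq.flip hu
  obtain ⟨k, hk, hk'⟩ := hT.homotopy_lifting hu' (𝟙 E') (w := u' ≫ f ≫ s) (by
    simpa using hT.homotopic_symm (homotopic_comp_left u' hfs))
  let s' : A ⟶ E' := sq.lift (𝟙 A) (u ≫ s) (by simp [hs])
  have hs'₁ : s' ≫ f' = 𝟙 A := by simp [s']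
  have hs'₂ : s' ≫ u' = u ≫ s := by simp [s']
  have hks : k ≫ f' ≫ s' = k := by
    refine sq.hom_ext (by simp [hs'₁]) ?_
    simp only [Category.assoc, hs'₂, sq.w_assoc]
    rw [reassoc_of% hk, reassoc_of% hs, hk]
  refine ⟨s', ?_, by rw [hs'₁]; exact hT.homotopic_refl _⟩
  have h₁ : TribeHomotopic fib (𝟙 E' ≫ f' ≫ s') (k ≫ f' ≫ s') :=
    hT.homotopic_comp_right (f' ≫ s') hk'
  rw [hks, Category.id_comp] at h₁
  exact hT.homotopic_trans h₁ (hT.homotopic_symm hk')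

/-- Trivial fibrations are stable under base change: the map of bases is an anodyne map followed by
a fibration, and the base change of an anodyne map along a fibration is again anodyne. -/
lemma weakEquivalence_baseChange (hT : IsTribe fib) {E' E A B : T} {f' : E' ⟶ A}
    {u' : E' ⟶ E} {u : A ⟶ B} {f : E ⟶ B} (sq : IsPullback f' u' u f) (hf : fib f)
    (hw : IsTribeWeakEquivalence fib f) : IsTribeWeakEquivalence fib f' := by
  obtain ⟨C, i, p, hi, hp, rfl⟩ := hT.factorization u
  obtain ⟨E'', f'', p', sq'⟩ := hT.exists_isPullback p f hf
  have hf'' : fib f'' := hT.fib_baseChange sq' hf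
  have hw'' := hT.weakEquivalence_baseChange_fib sq' hf hw hp
  let j : E' ⟶ E'' := sq'.lift (f' ≫ i) u' (by simpa using sq.w)
  have sq'' : IsPullback j f' f'' i := by
    refine IsPullback.of_right (h₁₂ := p') (h₂₂ := p) (v₁₃ := f) ?_ (by simp [j]) sq'.flip
    simpa [j] using sq.flip
  have hj : fib.llp j := hT.anodyne_baseChange sq'' hf'' hi
  refine hT.weakEquivalence_of_comp_right (hT.weakEquivalence_of_anodyne hi) ?_
  rw [← sq''.w]
  exact hT.weakEquivalence_comp (hT.weakEquivalence_of_anodyne hj) hw''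

end IsTribe

/-! ### Discrete objects of a tribe -/

/-- An object is discrete if its diagonal is a fibration, that is, if it is its own path object. -/
def IsTribeDiscrete (fib : MorphismProperty T) [HasBinaryProducts T] (A : T) : Prop :=
  fib (diag A)

variable [HasBinaryProducts T]

namespace IsTribeDiscrete

variable {A : T}

lemma hom_ext_of_anodyne (hA : IsTribeDiscrete fib A) {X Z : T} {i : X ⟶ Z} (hi : fib.llp i)
    {f g : Z ⟶ A} (h : i ≫ f = i ≫ g) : f = g := by
  obtain ⟨l, -, hl⟩ := hi.exists_lift hA (i ≫ f) (prod.lift f g) (by ext <;> simp [h])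
  have h₁ := congrArg (· ≫ prod.fst) hl
  have h₂ := congrArg (· ≫ prod.snd) hl
  simp at h₁ h₂
  exact h₁.symm.trans h₂

lemma of_iso (hT : IsTribe fib) (hA : IsTribeDiscrete fib A) {B : T} (e : B ≅ A) :
    IsTribeDiscrete fib B := by
  have : diag B = e.hom ≫ diag A ≫ prod.map e.inv e.inv := by ext <;> simp
  rw [IsTribeDiscrete, this]
  exact hT.fib_comp _ _ (hT.fib_of_isIso _ inferInstance)
    (hT.fib_comp _ _ hA (hT.fib_of_isIso _ inferInstance))

/-- The graph of a map to a discrete object is a fibration, a base change of the diagonal. -/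
lemma fib_graph (hT : IsTribe fib) (hA : IsTribeDiscrete fib A) {E : T} (f : E ⟶ A) :
    fib (prod.lift f (𝟙 E)) := by
  refine hT.fib_baseChange (f' := f) (f := prod.map (𝟙 A) f) (p := diag A) ?_ hA
  refine ⟨⟨by ext <;> simp⟩, ⟨PullbackCone.IsLimit.mk _ (fun s => s.fst ≫ prod.snd)
    (fun s => ?_) (fun s => ?_) (fun s m h₁ _ => ?_)⟩⟩
  · have h₁ := congrArg (· ≫ prod.fst) s.condition
    have h₂ := congrArg (· ≫ prod.snd) s.condition
    simp at h₁ h₂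
    ext <;> simp [h₁, h₂]
  · have h₂ := congrArg (· ≫ prod.snd) s.condition
    simpa using h₂
  · simp [← h₁]

lemma fib_lift (hT : IsTribe fib) (hA : IsTribeDiscrete fib A) {E S : T} {p : E ⟶ S}
    (hp : fib p) (f : E ⟶ A) : fib (prod.lift f p) := by
  have : prod.lift f p = prod.lift f (𝟙 E) ≫ prod.map (𝟙 A) p := by ext <;> simp
  rw [this]
  refine hT.fib_comp _ _ (hA.fib_graph hT f) ?_
  refine hT.fib_baseChange (f' := prod.snd) (f := prod.snd) (p := p) ?_ hp
  refine ⟨⟨by simp⟩, ⟨PullbackCone.IsLimit.mk _ (fun s => prod.lift (s.fst ≫ prod.fst) s.snd)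
    (fun s => ?_) (fun s => by simp) (fun s m h₁ h₂ => ?_)⟩⟩
  · ext <;> simp [s.condition]
  · ext <;> simp [← h₁, ← h₂]

/-- Every map to a discrete object is a fibration. -/
lemma fib_of_target (hT : IsTribe fib) (hA : IsTribeDiscrete fib A) {E : T} (f : E ⟶ A) :
    fib f := by
  have : f = prod.lift f (𝟙 E) ≫ prod.fst := by simp
  rw [this]
  exact hT.fib_comp _ _ (hA.fib_graph hT f) (hT.fib_fst _ _)

lemma of_isPullback (hT : IsTribe fib) (hA : IsTribeDiscrete fib A) {B P S : T}
    (hB : IsTribeDiscrete fib B) {a : P ⟶ A} {b : P ⟶ B} {f : A ⟶ S} {g : B ⟶ S}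
    (sq : IsPullback a b f g) : IsTribeDiscrete fib P := by
  let j : P ⨯ P ⟶ (A ⨯ B) ⨯ P := prod.map (prod.lift a b) (𝟙 P)
  have hm : Mono (prod.lift a b) := ⟨fun u w h => by
    have h₁ := congrArg (· ≫ prod.fst) h
    have h₂ := congrArg (· ≫ prod.snd) h
    simp at h₁ h₂
    exact sq.hom_ext h₁ h₂⟩
  have : Mono j := inferInstance
  refine hT.fib_of_mono (diag P) j ?_
  have e : diag P ≫ j = prod.lift a (prod.lift b (𝟙 P)) ≫ (prod.associator A B P).inv := by
    ext <;> simp [j]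
  rw [e]
  refine hT.fib_comp _ _ (hA.fib_lift hT (hB.fib_graph hT b) a) (hT.fib_of_isIso _ inferInstance)

/-- A weak equivalence whose graph is a fibration has a discrete target. If `g` is a homotopy
inverse of `f`, then `(g ≫ f, 𝟙) : A ⟶ A × A` is a base change of the graph; transport along it
of the homotopy from `g ≫ f` to the identity shows that `g ≫ f = 𝟙`. -/
lemma of_fib_graph (hT : IsTribe fib) {E : T} (f : E ⟶ A) (hw : IsTribeWeakEquivalence fib f)
    (hf : fib (prod.lift f (𝟙 E))) : IsTribeDiscrete fib A := by
  obtain ⟨g, -, H⟩ := hw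
  have hr : fib (prod.lift (g ≫ f) (𝟙 A)) := by
    refine hT.fib_baseChange (f' := g) (f := prod.map (𝟙 A) g) (p := prod.lift f (𝟙 E)) ?_ hf
    refine ⟨⟨by ext <;> simp⟩, ⟨PullbackCone.IsLimit.mk _ (fun s => s.fst ≫ prod.snd)
      (fun s => ?_) (fun s => ?_) (fun s m h₁ _ => ?_)⟩⟩
    · have h₁ := congrArg (· ≫ prod.fst) s.condition
      have h₂ := congrArg (· ≫ prod.snd) s.condition
      simp at h₁ h₂
      ext <;> simp [h₁, reassoc_of% h₂]
    · have h₂ := congrArg (· ≫ prod.snd) s.condition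
      simpa using h₂
    · simp [← h₁]
  have hq : fib (g ≫ f) := by
    simpa using hT.fib_comp _ _ hr (hT.fib_fst A A)
  obtain ⟨P, s, d, hs, hd, hsd⟩ := hT.exists_pathObject A
  obtain ⟨h, hh⟩ := H.exists_lift hd hsd
  have hs₀ : s ≫ d ≫ prod.fst = 𝟙 A := by simp [reassoc_of% hsd]
  have hs₁ : s ≫ d ≫ prod.snd = 𝟙 A := by simp [reassoc_of% hsd]
  obtain ⟨W, a, b, sq⟩ := hT.exists_isPullback (g ≫ f) (d ≫ prod.fst)
    (hT.fib_comp _ _ hd (hT.fib_fst A A))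
  have hi : fib.llp (sq.lift (𝟙 A) ((g ≫ f) ≫ s) (by simp [hs₀])) :=
    hT.anodyne_baseChange_section sq hq hs hs₀ (by simp) (by simp)
  obtain ⟨t, -, ht⟩ := hi.exists_lift hr (𝟙 A) (prod.lift (b ≫ d ≫ prod.snd) a) (by
    ext
    · simp only [Category.assoc, prod.lift_fst, IsPullback.lift_snd_assoc, hs₁]
      simp
    · simp)
  have ht₁ : t ≫ g ≫ f = b ≫ d ≫ prod.snd := by simpa using congrArg (· ≫ prod.fst) ht
  have ht₂ : t = a := by simpa using congrArg (· ≫ prod.snd) ht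
  have hgf : g ≫ f = 𝟙 A := by
    have w₀ : 𝟙 A ≫ g ≫ f = h ≫ d ≫ prod.fst := by simp [reassoc_of% hh]
    have := congrArg (fun k => sq.lift (𝟙 A) h w₀ ≫ k) ht₁
    simpa [ht₂, reassoc_of% hh] using this
  rw [hgf] at hr
  exact hr

end IsTribeDiscrete

end Tribe

/-! ### Direct categories and identities -/

section Identities

variable {C : Type u} [Category.{v} C]

lemma identities_iff_eq_id {a : C} (f : a ⟶ a) :
    MorphismProperty.identities C f ↔ f = 𝟙 a :=
  ⟨fun h => by obtain ⟨⟩ := h; rfl, fun h => h ▸ ⟨a⟩⟩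

lemma isIso_of_identities {a b : C} {f : a ⟶ b} (h : MorphismProperty.identities C f) :
    IsIso f := by
  obtain ⟨⟩ := h; infer_instance

lemma IsDirectCategory.identities_of_isIso (hC : IsDirectCategory C) {x y : C} (k : x ⟶ y)
    [IsIso k] : MorphismProperty.identities C k := by
  obtain ⟨deg, hdeg⟩ := hC
  by_contra hk
  have inv_mem : ∀ {x y : C} (j : x ⟶ y) [IsIso j], MorphismProperty.identities C j →
      MorphismProperty.identities C (inv j) := by
    rintro _ _ j _ ⟨⟩
    rw [IsIso.inv_id]
    exact ⟨_⟩
  have hk' : ¬ MorphismProperty.identities C (inv k) := fun h => hk (by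
    simpa using inv_mem (inv k) h)
  exact lt_asymm (hdeg k hk) (hdeg _ hk')

end Identities

/-! ### Words in the category `F_≃(R)` -/

section FreeIso

variable {R₀ : Type u} [Category.{v} R₀] {R : Type u'} [Category.{v'} R] (c : R₀ ⥤ R)

/-- The arrows of `R` that are images of arrows of `R₀`. -/
inductive IsFromDirect : MorphismProperty R
  | mk {x y : R₀} (k : x ⟶ y) : IsFromDirect (c.map k)

variable {c} in
lemma IsFromDirect.exists_source {a b : R} {l : a ⟶ b} (h : IsFromDirect c l) :
    ∃ x, a = c.obj x := by
  obtain ⟨k⟩ := h; exact ⟨_, rfl⟩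

variable {c} in
lemma IsFromDirect.exists_target {a b : R} {l : a ⟶ b} (h : IsFromDirect c l) :
    ∃ x, b = c.obj x := by
  obtain ⟨k⟩ := h; exact ⟨_, rfl⟩

variable {c} in
lemma IsFromDirect.identities_of_isIso (hR₀ : IsDirectCategory R₀) (hc : c.ReflectsIsomorphisms)
    {a b : R} {l : a ⟶ b} (h : IsFromDirect c l) (hl : IsIso l) :
    MorphismProperty.identities R l := by
  obtain ⟨k⟩ := h
  have := isIso_of_reflects_iso k c
  obtain ⟨⟩ := hR₀.identities_of_isIso k
  rw [c.map_id]
  exact ⟨_⟩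

namespace FreeIsoCat

/-- An object of `R`, seen in `F_≃(R)`. -/
abbrev ofObj (a : R) : FreeIsoCat c := ⟨a⟩

variable {c} in
/-- The object of `R` underlying an object of `F_≃(R)`. -/
abbrev baseObj (a : FreeIsoCat c) : R := a.as

variable {c} in
/-- The class in `F_≃(R)` of the path of length one on an arrow of `R`. -/
def letter {a : FreeIsoCat c} {b : R} (l : baseObj a ⟶ b) : a ⟶ ofObj c b :=
  (FreeIsoCat.ofFree c).map ((Paths.of R).map l)

variable {c}

@[simp]
lemma toBase_map_letter {a : FreeIsoCat c} {b : R} (l : baseObj a ⟶ b) :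
    (FreeIsoCat.toBase c).map (letter l) = l :=
  composePath_toPath l

lemma identities_letter (hR₀ : IsDirectCategory R₀) (hc : c.ReflectsIsomorphisms)
    {a : FreeIsoCat c} {b : R} {l : baseObj a ⟶ b} (h : IsFromDirect c l) (hl : IsIso l) :
    MorphismProperty.identities _ (letter l) := by
  have key : ∀ {m : R} (l : m ⟶ b), IsFromDirect c l → MorphismProperty.identities R l →
      MorphismProperty.identities _ (letter (a := ofObj c m) l) := by
    rintro _ _ h ⟨⟩
    obtain ⟨x, rfl⟩ := h.exists_source
    rw [← c.map_id x]
    exact (identities_iff_eq_id (C := FreeIsoCat c) _).2 ((FreeIsoCat.ofDirect c).map_id x)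
  exact key l h (h.identities_of_isIso hR₀ hc hl)

/-- Induction on words, appending letters. -/
lemma induction_append {a : FreeIsoCat c} {P : ∀ {b : FreeIsoCat c}, (a ⟶ b) → Prop}
    (id : P (𝟙 a))
    (comp : ∀ {m : FreeIsoCat c} {b : R} (g : a ⟶ m) (l : baseObj m ⟶ b), P g → P (g ≫ letter l)) :
    ∀ {b : FreeIsoCat c} (g : a ⟶ b), P g := by
  intro b g
  obtain ⟨p, rfl⟩ := (CategoryTheory.Quotient.functor (FreeIsoRel c)).map_surjective
    (X := a.as) (Y := b.as) g
  refine Paths.induction_fixed_source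
    (fun {d} p => P ((CategoryTheory.Quotient.functor (FreeIsoRel c)).map p)) ?_ ?_ p
  · exact id
  · intro m b p l hp
    rw [Functor.map_comp]
    exact comp (m := ⟨m⟩) _ l hp

/-- Induction on words, prepending letters. -/
lemma induction_prepend {b : FreeIsoCat c} {P : ∀ {a : FreeIsoCat c}, (a ⟶ b) → Prop}
    (id : P (𝟙 b))
    (comp : ∀ {a : FreeIsoCat c} {m : R} (l : baseObj a ⟶ m) (g : ofObj c m ⟶ b),
      P g → P (letter l ≫ g)) :
    ∀ {a : FreeIsoCat c} (g : a ⟶ b), P g := by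
  intro a g
  obtain ⟨p, rfl⟩ := (CategoryTheory.Quotient.functor (FreeIsoRel c)).map_surjective
    (X := a.as) (Y := b.as) g
  refine Paths.induction_fixed_target
    (fun {d} p => P ((CategoryTheory.Quotient.functor (FreeIsoRel c)).map p)) ?_ ?_ p
  · exact id
  · intro m a p l hp
    rw [Functor.map_comp]
    exact comp (a := ⟨m⟩) (m := a) l _ hp

/-- An action of the arrows of `R` on a family of types that is functorial on `R₀` extends to an
action of `F_≃(R)`. -/
lemma exists_action (X : R → Type*) (act : ∀ ⦃a b : R⦄, (a ⟶ b) → X a → X b)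
    (h₀ : ∀ (x : R₀) (s), act (c.map (𝟙 x)) s = s)
    (h : ∀ ⦃x y z : R₀⦄ (k : x ⟶ y) (l : y ⟶ z) (s),
      act (c.map (k ≫ l)) s = act (c.map l) (act (c.map k) s)) :
    ∃ S : ∀ ⦃a b : FreeIsoCat c⦄, (a ⟶ b) → X (baseObj a) → X (baseObj b),
      (∀ a s, S (𝟙 a) s = s) ∧
      (∀ ⦃a b d : FreeIsoCat c⦄ (f : a ⟶ b) (g : b ⟶ d) (s), S (f ≫ g) s = S g (S f s)) ∧
      ∀ ⦃a : FreeIsoCat c⦄ ⦃b : R⦄ (l : baseObj a ⟶ b) (s), S (letter l) s = act l s := by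
  let φ : R ⥤q Type _ := { obj := X, map := fun l => TypeCat.ofHom (act l) }
  let F₀ : Paths R ⥤ Type _ := Paths.lift φ
  have hF₀ : ∀ {a b : R} (l : a ⟶ b), F₀.map ((Paths.of R).map l) = TypeCat.ofHom (act l) :=
    fun l => Paths.lift_toPath φ l
  let F : FreeIsoCat c ⥤ Type _ :=
    CategoryTheory.Quotient.lift (FreeIsoRel c) F₀ (by
      rintro _ _ _ _ (x | ⟨k, l⟩)
      · rw [hF₀, F₀.map_id]
        ext s
        exact h₀ x s
      · rw [F₀.map_comp, hF₀, hF₀, hF₀]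
        ext s
        exact h k l s)
  refine ⟨fun a b f s => (F.map f : F.obj a ⟶ F.obj b) s, fun a s => ?_, fun a b d f g s => ?_,
    fun a b l s => ?_⟩
  · exact congrArg (fun t : F.obj a ⟶ F.obj a => t s) (F.map_id a)
  · exact congrArg (fun t : F.obj a ⟶ F.obj d => t s) (F.map_comp f g)
  · exact congrArg (fun t : F.obj a ⟶ F.obj (ofObj c b) => t s) (hF₀ l)

/-- A function on the arrows of `R` that is additive on `R₀` extends to an additive function on
the arrows of `F_≃(R)`. -/
lemma exists_weight (w : ∀ ⦃a b : R⦄, (a ⟶ b) → ℕ) (h₀ : ∀ x : R₀, w (c.map (𝟙 x)) = 0)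
    (h : ∀ ⦃x y z : R₀⦄ (k : x ⟶ y) (l : y ⟶ z),
      w (c.map (k ≫ l)) = w (c.map k) + w (c.map l)) :
    ∃ N : ∀ ⦃a b : FreeIsoCat c⦄, (a ⟶ b) → ℕ, (∀ a, N (𝟙 a) = 0) ∧
      (∀ ⦃a b d : FreeIsoCat c⦄ (f : a ⟶ b) (g : b ⟶ d), N (f ≫ g) = N f + N g) ∧
      ∀ ⦃a : FreeIsoCat c⦄ ⦃b : R⦄ (l : baseObj a ⟶ b), N (letter l) = w l := by
  obtain ⟨S, hS₀, hS, hSl⟩ := exists_action (c := c) (fun _ => ℕ) (fun _ _ l n => n + w l)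
    (fun x n => by rw [h₀, add_zero]) (fun x y z k l n => by rw [h, add_assoc])
  have key : ∀ {a b : FreeIsoCat c} (g : a ⟶ b) (n : ℕ), S g n = n + S g 0 := fun {a b} g =>
    induction_append (P := fun {b} g => ∀ n : ℕ, S g n = n + S g 0)
      (fun n => by rw [hS₀, hS₀, add_zero])
      (fun g l ih n => by rw [hS, hS, hSl, hSl, ih, add_assoc]) g
  exact ⟨fun a b f => S f 0, fun a => hS₀ a 0,
    fun a b d f g => (hS f g 0).trans (key g _), fun a b l => (hSl l 0).trans (zero_add _)⟩

open Classical in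
/-- There is an additive length function on the arrows of `F_≃(R)` that vanishes exactly on
identities: the sum of the rise in degree and the number of letters that are not from `R₀`. -/
lemma exists_length (hR₀ : IsDirectCategory R₀) (hR : IsGeneralizedDirectCategory R)
    (hc : c.ReflectsIsomorphisms) :
    ∃ N : ∀ ⦃a b : FreeIsoCat c⦄, (a ⟶ b) → ℕ,
      (∀ ⦃a b d : FreeIsoCat c⦄ (f : a ⟶ b) (g : b ⟶ d), N (f ≫ g) = N f + N g) ∧
      ∀ ⦃a b : FreeIsoCat c⦄ (f : a ⟶ b), N f = 0 ↔ MorphismProperty.identities _ f := by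
  obtain ⟨deg, hdeg⟩ := hR
  have mono : ∀ ⦃a b : R⦄ (_ : a ⟶ b), deg a ≤ deg b := fun a b f => by
    by_cases hf : IsIso f
    · exact ((hdeg f).1 hf).le
    · exact ((hdeg f).2 hf).le
  obtain ⟨N, hN₀, hN, hNl⟩ := exists_weight (c := c)
    (fun a b l => (deg b - deg a) + if IsFromDirect c l then 0 else 1)
    (fun x => by rw [if_pos (.mk _), Nat.sub_self])
    (fun x y z k l => by
      rw [if_pos (.mk _), if_pos (.mk _), if_pos (.mk _)]
      have := mono (c.map k)
      have := mono (c.map l)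
      omega)
  refine ⟨N, hN, fun a b f => ⟨?_, ?_⟩⟩
  · refine induction_append (P := fun {b} f => N f = 0 → MorphismProperty.identities _ f) ?_ ?_ f
    · exact fun _ => ⟨_⟩
    · intro m b g l ih hgl
      rw [hN, hNl] at hgl
      refine (MorphismProperty.identities _).comp_mem _ _ (ih (by omega)) ?_
      have hl : IsFromDirect c l := by
        by_contra hl
        rw [if_neg hl] at hgl
        omega
      have hiso : IsIso l := by
        by_contra hl
        have := (hdeg l).2 hl
        omega
      exact identities_letter hR₀ hc hl hiso
  · rintro ⟨⟩
    exact hN₀ _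

open Classical in
/-- The letters not from `R₀` can be counted, those that are not invertible being counted twice. -/
lemma exists_freeLength (c : R₀ ⥤ R) :
    ∃ N : ∀ ⦃a b : FreeIsoCat c⦄, (a ⟶ b) → ℕ, (∀ a, N (𝟙 a) = 0) ∧
      (∀ ⦃a b d : FreeIsoCat c⦄ (f : a ⟶ b) (g : b ⟶ d), N (f ≫ g) = N f + N g) ∧
      ∀ ⦃a : FreeIsoCat c⦄ ⦃b : R⦄ (l : baseObj a ⟶ b), N (letter l) =
        if IsFromDirect c l then 0 else if IsIso l then 1 else 2 :=
  exists_weight (fun _ _ l => if IsFromDirect c l then 0 else if IsIso l then 1 else 2)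
    (fun x => by rw [if_pos (.mk _)])
    (fun x y z k l => by rw [if_pos (.mk _), if_pos (.mk _), if_pos (.mk _)])

/-- The number of letters not from `R₀` in an arrow of `F_≃(R)`, those that are not invertible
being counted twice. -/
noncomputable def freeLength ⦃a b : FreeIsoCat c⦄ (f : a ⟶ b) : ℕ :=
  (exists_freeLength c).choose f

@[simp]
lemma freeLength_id (a : FreeIsoCat c) : freeLength (𝟙 a) = 0 :=
  (exists_freeLength c).choose_spec.1 a

@[simp]
lemma freeLength_comp {a b d : FreeIsoCat c} (f : a ⟶ b) (g : b ⟶ d) :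
    freeLength (f ≫ g) = freeLength f + freeLength g :=
  (exists_freeLength c).choose_spec.2.1 f g

open Classical in
lemma freeLength_letter {a : FreeIsoCat c} {b : R} (l : baseObj a ⟶ b) : freeLength (letter l) =
    if IsFromDirect c l then 0 else if IsIso l then 1 else 2 :=
  (exists_freeLength c).choose_spec.2.2 l

lemma freeLength_letter_eq_zero_iff {a : FreeIsoCat c} {b : R} (l : baseObj a ⟶ b) :
    freeLength (letter l) = 0 ↔ IsFromDirect c l := by
  rw [freeLength_letter]; split_ifs <;> simp_all

lemma isIso_of_freeLength_letter_eq_one {a : FreeIsoCat c} {b : R} {l : baseObj a ⟶ b}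
    (h : freeLength (letter l) = 1) : IsIso l := by
  rw [freeLength_letter] at h
  split_ifs at h
  · assumption
  · omega

/-- A factorization of an arrow as an arrow with letters from `R₀` followed by a letter not from
`R₀` is unique. -/
lemma cancel_letter {a m m' : FreeIsoCat c} {b : R} {f : a ⟶ m} {f' : a ⟶ m'} {l : baseObj m ⟶ b}
    {l' : baseObj m' ⟶ b} (hf : freeLength f = 0) (hf' : freeLength f' = 0) (hl : ¬ IsFromDirect c l)
    (hl' : ¬ IsFromDirect c l') (h : f ≫ letter l = f' ≫ letter l') :
    m = m' ∧ HEq f f' ∧ HEq l l' := by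
  classical
  -- the action records the first letter not from `R₀`, and what precedes it
  let X : R → Type _ := fun b => (a ⟶ ofObj c b) ⊕ Σ m m' : R, (a ⟶ ofObj c m) × (m ⟶ m')
  let act : ∀ ⦃b b' : R⦄, (b ⟶ b') → X b → X b' := fun b b' l s =>
    Sum.elim (fun h => if IsFromDirect c l then Sum.inl (h ≫ letter (a := ofObj c b) l)
      else Sum.inr ⟨b, b', h, l⟩) Sum.inr s
  have act_inl : ∀ ⦃b b' : R⦄ (l : b ⟶ b') (h : a ⟶ ofObj c b), IsFromDirect c l →
      act l (Sum.inl h) = Sum.inl (h ≫ letter (a := ofObj c b) l) := fun _ _ _ _ hl => if_pos hl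
  obtain ⟨S, hS₀, hS, hSl⟩ := exists_action (c := c) X act
    (by
      rintro x (h | t)
      · refine (act_inl _ _ (.mk _)).trans (congrArg Sum.inl ?_)
        exact (congrArg (h ≫ ·) ((FreeIsoCat.ofDirect c).map_id x)).trans (Category.comp_id h)
      · rfl)
    (by
      rintro x y z k l (h | t)
      · rw [act_inl _ _ (.mk _), act_inl _ _ (.mk _), act_inl _ _ (.mk _)]
        refine congrArg Sum.inl ?_
        exact (congrArg (h ≫ ·) ((FreeIsoCat.ofDirect c).map_comp k l)).trans
          (Category.assoc _ _ _).symm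
      · rfl)
  have hS' : ∀ {b : FreeIsoCat c} (g : a ⟶ b), freeLength g = 0 →
      S g (Sum.inl (𝟙 a)) = Sum.inl g := fun {b} g =>
    induction_append (P := fun {b} g => freeLength g = 0 → S g (Sum.inl (𝟙 a)) = Sum.inl g)
      (fun _ => hS₀ a _)
      (fun {m b} g l ih hgl => by
        rw [freeLength_comp, Nat.add_eq_zero_iff, freeLength_letter_eq_zero_iff] at hgl
        rw [hS, ih hgl.1, hSl]
        exact if_pos hgl.2) g
  have key : ∀ {m : FreeIsoCat c} {f : a ⟶ m} {l : baseObj m ⟶ b}, freeLength f = 0 →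
      ¬ IsFromDirect c l → S (f ≫ letter l) (Sum.inl (𝟙 a)) = Sum.inr ⟨baseObj m, b, f, l⟩ := by
    intro m f l hf hl
    rw [hS, hS' f hf, hSl]
    exact if_neg hl
  have h' := Sum.inr.inj
    ((key hf hl).symm.trans ((congrArg (fun g => S g (Sum.inl (𝟙 a))) h).trans (key hf' hl')))
  obtain ⟨m⟩ := m
  obtain ⟨m'⟩ := m'
  obtain ⟨e, h''⟩ := Sigma.mk.inj h'
  change m = m' at e
  subst e
  have h₃ := (Sigma.mk.inj (eq_of_heq h'')).2
  obtain ⟨rfl, rfl⟩ := Prod.mk.inj (eq_of_heq h₃)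
  exact ⟨rfl, HEq.rfl, HEq.rfl⟩

end FreeIsoCat

end FreeIso

/-! ### The arrows of `F_≃(R)` that factor objects of `D_R` -/

section DRObjects

variable {R₀ : Type u} [Category.{v} R₀] {R : Type u'} [Category.{v'} R] {c : R₀ ⥤ R}

namespace FreeIsoCat

/-- The vertices are the objects of `F_≃(R)` that come from `R₀`. They are the objects whose
identity belongs to `D_R`. -/
def IsVertex (a : FreeIsoCat c) : Prop := ∃ x : R₀, a = ofObj c (c.obj x)

lemma IsVertex.of_identities {a b : FreeIsoCat c} {f : a ⟶ b}
    (hf : MorphismProperty.identities _ f) (h : IsVertex b) : IsVertex a := by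
  obtain ⟨⟩ := hf; exact h

lemma IsVertex.target {a b : FreeIsoCat c} (h : IsVertex a) {f : a ⟶ b}
    (hf : MorphismProperty.identities _ f) : IsVertex b := by
  obtain ⟨⟩ := hf; exact h

lemma IsVertex.isDRObject_id {a : FreeIsoCat c} (h : IsVertex a) : IsDRObject c ⟨a, a, 𝟙 a⟩ := by
  obtain ⟨x, rfl⟩ := h
  exact congrArg (fun f => IsDRObject c ⟨_, _, f⟩) ((FreeIsoCat.ofDirect c).map_id x) ▸
    IsDRObject.ofDirect (c := c) (𝟙 x)

lemma isVertex_source {a : FreeIsoCat c} {b : R} {l : baseObj a ⟶ b} (h : IsFromDirect c l) :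
    IsVertex a := by
  obtain ⟨x, hx⟩ := h.exists_source
  obtain ⟨a⟩ := a
  exact ⟨x, congrArg (ofObj c) hx⟩

lemma isVertex_target {a b : R} {l : a ⟶ b} (h : IsFromDirect c l) : IsVertex (ofObj c b) := by
  obtain ⟨x, rfl⟩ := h.exists_target
  exact ⟨x, rfl⟩

lemma not_identities_letter {a : FreeIsoCat c} {b : R} {l : baseObj a ⟶ b}
    (h : ¬ IsFromDirect c l) : ¬ MorphismProperty.identities _ (letter l) := fun h' => h (by
  rw [← freeLength_letter_eq_zero_iff]
  generalize letter l = f at h'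
  obtain ⟨⟩ := h'
  exact freeLength_id _)

lemma freeLength_letter_le {a : FreeIsoCat c} {b : R} (l : baseObj a ⟶ b) (hl : IsIso l) :
    freeLength (letter l) ≤ 1 := by
  classical
  rw [freeLength_letter, if_pos hl]
  split_ifs <;> omega

lemma identities_map_ofDirect {x y : R₀} {k : x ⟶ y} (hk : MorphismProperty.identities R₀ k) :
    MorphismProperty.identities _ ((FreeIsoCat.ofDirect c).map k) := by
  obtain ⟨⟩ := hk
  exact (identities_iff_eq_id (C := FreeIsoCat c) _).2 ((FreeIsoCat.ofDirect c).map_id _)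

lemma isVertex_or_freeLength_pos {a b : FreeIsoCat c} (f : a ⟶ b) (ha : IsVertex a) :
    IsVertex b ∨ 0 < freeLength f := by
  refine induction_append (P := fun {b} f => IsVertex b ∨ 0 < freeLength f) (Or.inl ha) ?_ f
  intro m b g l ih
  by_cases hl : IsFromDirect c l
  · exact Or.inl (isVertex_target hl)
  · rw [← freeLength_letter_eq_zero_iff] at hl
    rw [freeLength_comp]
    omega

/-- A non-identity arrow has a first non-identity letter. -/
lemma exists_first_letter {a b : FreeIsoCat c} (f : a ⟶ b)
    (hf : ¬ MorphismProperty.identities _ f) :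
    ∃ (m : R) (l : baseObj a ⟶ m) (r : ofObj c m ⟶ b), f = letter l ≫ r ∧
      ¬ MorphismProperty.identities _ (letter l) := by
  have key : ∀ {a d : FreeIsoCat c} (e : a ⟶ d) (g : d ⟶ b),
      MorphismProperty.identities _ e →
      (∃ (m : R) (l : baseObj d ⟶ m) (r : ofObj c m ⟶ b), g = letter l ≫ r ∧
        ¬ MorphismProperty.identities _ (letter l)) →
      ∃ (m : R) (l : baseObj a ⟶ m) (r : ofObj c m ⟶ b), e ≫ g = letter l ≫ r ∧
        ¬ MorphismProperty.identities _ (letter l) := by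
    rintro _ _ _ g ⟨⟩ h
    rwa [Category.id_comp]
  revert hf
  refine induction_prepend (P := fun {a} f => ¬ MorphismProperty.identities _ f →
    ∃ (m : R) (l : baseObj a ⟶ m) (r : ofObj c m ⟶ b), f = letter l ≫ r ∧
      ¬ MorphismProperty.identities _ (letter l)) ?_ ?_ f
  · exact fun h => (h ⟨_⟩).elim
  · intro a m l g ih hlg
    by_cases hl : MorphismProperty.identities _ (letter l)
    · exact key _ _ hl (ih fun hg => hlg ((MorphismProperty.identities _).comp_mem _ _ hl hg))
    · exact ⟨m, l, g, rfl, hl⟩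

lemma isVertex_of_freeLength_eq_zero {a b : FreeIsoCat c} (f : a ⟶ b)
    (hf : ¬ MorphismProperty.identities _ f) (h : freeLength f = 0) : IsVertex a := by
  obtain ⟨m, l, r, rfl, -⟩ := exists_first_letter f hf
  rw [freeLength_comp, Nat.add_eq_zero_iff, freeLength_letter_eq_zero_iff] at h
  exact isVertex_source h.1

/-- The intermediate objects of an arrow that starts at a vertex and has at most one letter not
from `R₀` are vertices. -/
lemma isVertex_of_comp {a m b : FreeIsoCat c} (f : a ⟶ m) (g : m ⟶ b) (ha : IsVertex a)
    (hg : ¬ MorphismProperty.identities _ g) (h : freeLength (f ≫ g) ≤ 1) : IsVertex m := by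
  by_contra hm
  have h₁ := (isVertex_or_freeLength_pos f ha).resolve_left hm
  have h₂ : freeLength g ≠ 0 := fun h₂ => hm (isVertex_of_freeLength_eq_zero g hg h₂)
  rw [freeLength_comp] at h
  omega

/-- An arrow from a vertex to an object that is not a vertex, with at most one letter not from
`R₀`, ends with an isomorphism of `R` that does not come from `R₀`. -/
lemma exists_last_letter {a b : FreeIsoCat c} (f : a ⟶ b) (ha : IsVertex a) (hb : ¬ IsVertex b)
    (h : freeLength f ≤ 1) :
    ∃ (m : FreeIsoCat c) (q : a ⟶ m) (l : baseObj m ⟶ baseObj b), f = q ≫ letter l ∧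
      IsVertex m ∧ freeLength q = 0 ∧ ¬ IsFromDirect c l ∧ IsIso l := by
  revert hb h
  refine induction_append (P := fun {b} f => ¬ IsVertex b → freeLength f ≤ 1 →
    ∃ (m : FreeIsoCat c) (q : a ⟶ m) (l : baseObj m ⟶ baseObj b), f = q ≫ letter l ∧
      IsVertex m ∧ freeLength q = 0 ∧ ¬ IsFromDirect c l ∧ IsIso l) ?_ ?_ f
  · exact fun h => (h ha).elim
  · intro m b g l _ hb h
    have hl : ¬ IsFromDirect c l := fun hl => hb (isVertex_target hl)
    have hl' := hl
    rw [← freeLength_letter_eq_zero_iff] at hl'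
    have h' := h
    rw [freeLength_comp] at h'
    exact ⟨m, g, l, rfl, isVertex_of_comp g _ ha (not_identities_letter hl) h, by omega, hl,
      isIso_of_freeLength_letter_eq_one (by omega)⟩

end FreeIsoCat

open FreeIsoCat

namespace IsDRObject

lemma isVertex_dom {o : TwistedArrow (FreeIsoCat c)} (h : IsDRObject c o) : IsVertex o.dom := by
  obtain ⟨k⟩ | ⟨k, w⟩ := h
  · exact ⟨_, rfl⟩
  · exact ⟨_, rfl⟩

lemma freeLength_le {o : TwistedArrow (FreeIsoCat c)} (h : IsDRObject c o) :
    freeLength o.arr ≤ 1 := by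
  have key : ∀ {x z : R₀} (k : x ⟶ z), freeLength ((FreeIsoCat.ofDirect c).map k) = 0 :=
    fun k => (freeLength_letter_eq_zero_iff (a := ofObj c (c.obj _)) _).2 (.mk k)
  obtain ⟨k⟩ | ⟨k, w⟩ := h
  · exact (key k).le.trans zero_le_one
  · refine (freeLength_comp ((FreeIsoCat.ofDirect c).map k)
      (letter (a := ofObj c (c.obj _)) w.hom)).le.trans ?_
    exact add_le_add (key k).le
      (freeLength_letter_le (a := ofObj c (c.obj _)) w.hom w.isIso_hom)

lemma of_letter {a : FreeIsoCat c} {b : R} (l : baseObj a ⟶ b) (ha : IsVertex a)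
    (h : freeLength (letter l) ≤ 1) : IsDRObject c ⟨a, ofObj c b, letter l⟩ := by
  by_cases hl : IsFromDirect c l
  · obtain ⟨a⟩ := a
    have key : ∀ {a b : R} (l : a ⟶ b), IsFromDirect c l →
        IsDRObject c ⟨ofObj c a, ofObj c b, letter l⟩ := by
      rintro _ _ _ ⟨k⟩
      exact .ofDirect k
    exact key l hl
  · obtain ⟨x, rfl⟩ := ha
    rw [← freeLength_letter_eq_zero_iff] at hl
    have : IsIso l := isIso_of_freeLength_letter_eq_one (by omega)
    have e : (FreeIsoCat.ofDirect c).map (𝟙 x) ≫ letter (a := ofObj c (c.obj x)) l = letter l :=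
      (congrArg (· ≫ letter (a := ofObj c (c.obj x)) l) ((FreeIsoCat.ofDirect c).map_id x)).trans
        (Category.id_comp _)
    exact congrArg (fun f => IsDRObject c ⟨ofObj c (c.obj x), ofObj c b, f⟩) e ▸
      IsDRObject.ofDirectIso (c := c) (𝟙 x) (asIso l)

end IsDRObject

/-! ### Special objects of `R` -/

variable (c) in
/-- An object of `R` is special if it is isomorphic to some `c(x)` that is the source of a
non-identity arrow of `R₀`, or of an isomorphism to some `c(y)` that does not come from `R₀`.
Equivalently, it is isomorphic to the source of an indecomposable arrow between vertices in `D_R`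
(`IsSpecial.exists_indecomposable`, `isSpecial_of_isDRObject`). These are the objects at
which the values of all frames turn out to be discrete. -/
def IsSpecial (a : R) : Prop :=
  ∃ x : R₀, Nonempty (a ≅ c.obj x) ∧
    ((∃ (y : R₀) (k : x ⟶ y), ¬ MorphismProperty.identities R₀ k) ∨
      ∃ (y : R₀) (w : c.obj x ≅ c.obj y), ¬ IsFromDirect c w.hom)

lemma IsSpecial.of_iso {a b : R} (h : IsSpecial c a) (e : b ≅ a) : IsSpecial c b := by
  obtain ⟨x, ⟨e'⟩, h⟩ := h
  exact ⟨x, ⟨e ≪≫ e'⟩, h⟩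

/-- Every arrow out of an object that is not special is invertible, being isomorphic to the image of
an arrow of `R₀` that can only be an identity. -/
lemma isIso_of_not_isSpecial (hlift : LiftsArrowsUpToIso c) {a b : R} (ha : ¬ IsSpecial c a)
    (f : a ⟶ b) : IsIso f := by
  obtain ⟨x, y, k, w, w', h⟩ := hlift f
  have hk : MorphismProperty.identities R₀ k := by
    by_contra hk
    exact ha ⟨x, ⟨w⟩, Or.inl ⟨y, k, hk⟩⟩
  have := isIso_of_identities hk
  obtain rfl : f = w.hom ≫ c.map k ≫ w'.inv := by
    rw [← Category.assoc, ← h, Category.assoc, Iso.hom_inv_id, Category.comp_id]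
  infer_instance

/-- Parallel arrows out of an object that is not special are equal: they differ by an automorphism of
some `c(x)`, which comes from `R₀` and so is an identity. -/
lemma hom_ext_of_not_isSpecial (hR₀ : IsDirectCategory R₀) (hc : c.ReflectsIsomorphisms)
    (hlift : LiftsArrowsUpToIso c) {a b : R} (ha : ¬ IsSpecial c a) (f g : a ⟶ b) : f = g := by
  have := isIso_of_not_isSpecial hlift ha f
  have := isIso_of_not_isSpecial hlift ha g
  obtain ⟨x, -, -, w, -, -⟩ := hlift (𝟙 a)
  let e : c.obj x ≅ c.obj x := w.symm ≪≫ asIso f ≪≫ (asIso g).symm ≪≫ w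
  have he : IsFromDirect c e.hom := by
    by_contra he
    exact ha ⟨x, ⟨w⟩, Or.inr ⟨x, e, he⟩⟩
  have he' := (identities_iff_eq_id _).1 (he.identities_of_isIso hR₀ hc inferInstance)
  have h : w.inv ≫ (f ≫ inv g) ≫ w.hom = 𝟙 _ := by simpa [e] using he'
  rw [← cancel_mono (inv g), IsIso.hom_inv_id, ← cancel_mono w.hom, ← cancel_epi w.inv, h]
  simp

lemma isSpecial_of_isDRObject {o : TwistedArrow (FreeIsoCat c)} (h : IsDRObject c o)
    (hR₀ : IsDirectCategory R₀) (hc : c.ReflectsIsomorphisms)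
    (hcod : IsVertex o.cod) (ho : ¬ MorphismProperty.identities _ o.arr) :
    IsSpecial c (baseObj o.dom) := by
  obtain ⟨k⟩ | ⟨k, w⟩ := h
  · exact ⟨_, ⟨Iso.refl _⟩, Or.inl ⟨_, k, fun hk => ho (identities_map_ofDirect hk)⟩⟩
  · by_cases hk : MorphismProperty.identities R₀ k
    · obtain ⟨z, hz⟩ := hcod
      obtain rfl := congrArg baseObj hz
      have hw : ¬ IsFromDirect c w.hom := fun hw => ho
        ((MorphismProperty.identities _).comp_mem _ _ (identities_map_ofDirect hk)
          (identities_letter (a := ofObj c (c.obj _)) hR₀ hc hw w.isIso_hom))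
      obtain ⟨⟩ := hk
      exact ⟨_, ⟨Iso.refl _⟩, Or.inr ⟨z, w, hw⟩⟩
    · exact ⟨_, ⟨Iso.refl _⟩, Or.inl ⟨_, k, hk⟩⟩

/-- A special object is isomorphic to the source of an object of `D_R` that is an indecomposable
arrow between vertices. -/
lemma IsSpecial.exists_indecomposable {a : R} (ha : IsSpecial c a) (hR₀ : IsDirectCategory R₀)
    (hR : IsGeneralizedDirectCategory R) (hc : c.ReflectsIsomorphisms) :
    ∃ (o : TwistedArrow (FreeIsoCat c)), IsDRObject c o ∧ Nonempty (a ≅ baseObj o.dom) ∧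
      IsVertex o.cod ∧ ¬ MorphismProperty.identities _ o.arr ∧
      ∀ {m : FreeIsoCat c} (f : o.dom ⟶ m) (g : m ⟶ o.cod), f ≫ g = o.arr →
        MorphismProperty.identities _ f ∨ MorphismProperty.identities _ g := by
  obtain ⟨N, hN, hN₀⟩ := exists_length hR₀ hR hc
  let S : Set ℕ := fun n => ∃ (o : TwistedArrow (FreeIsoCat c)), IsDRObject c o ∧
    Nonempty (a ≅ baseObj o.dom) ∧ IsVertex o.cod ∧ ¬ MorphismProperty.identities _ o.arr ∧
    N o.arr = n
  have hS : ∃ n, S n := by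
    obtain ⟨x, ⟨e⟩, ⟨y, k, hk⟩ | ⟨y, w, hw⟩⟩ := ha
    · refine ⟨_, ⟨_, _, (FreeIsoCat.ofDirect c).map k⟩, .ofDirect k, ⟨e⟩, ⟨y, rfl⟩,
        fun h => hk ?_, rfl⟩
      have h' : IsIso (c.map k) := toBase_map_letter (a := ofObj c (c.obj x)) (c.map k) ▸
        have := isIso_of_identities h
        inferInstanceAs (IsIso ((FreeIsoCat.toBase c).map ((FreeIsoCat.ofDirect c).map k)))
      have := isIso_of_reflects_iso k c
      exact hR₀.identities_of_isIso k
    · exact ⟨_, ⟨ofObj c (c.obj x), ofObj c (c.obj y), letter (a := ofObj c (c.obj x)) w.hom⟩,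
        .of_letter (a := ofObj c (c.obj x)) _ ⟨x, rfl⟩ 
          (freeLength_letter_le (a := ofObj c (c.obj x)) _ w.isIso_hom), ⟨e⟩, ⟨y, rfl⟩,
        not_identities_letter (a := ofObj c (c.obj x)) hw, rfl⟩
  classical
  obtain ⟨o, ho, ⟨e⟩, hcod, hid, hNo⟩ := Nat.find_spec hS
  refine ⟨o, ho, ⟨e⟩, hcod, hid, fun {m} f g hfg => ?_⟩
  by_contra! hcon
  obtain ⟨hf, hg⟩ := hcon
  obtain ⟨m', l, r, rfl, hl⟩ := exists_first_letter f hf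
  have hrg : ¬ MorphismProperty.identities _ (r ≫ g) := fun h => by
    rw [← hN₀, hN, Nat.add_eq_zero_iff, hN₀, hN₀] at h
    exact hg h.2
  have hle := ho.freeLength_le
  rw [← hfg, Category.assoc] at hle
  have hle' : freeLength (letter l) ≤ 1 := by
    rw [freeLength_comp] at hle
    omega
  have hlt : N (letter l) < Nat.find hS := by
    rw [← hNo, ← hfg, Category.assoc, hN]
    have : N (r ≫ g) ≠ 0 := fun h => hrg ((hN₀ _).1 h)
    omega
  exact Nat.find_min hS hlt ⟨⟨o.dom, ofObj c m', letter l⟩,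
    .of_letter l ho.isVertex_dom hle', ⟨e⟩,
    isVertex_of_comp _ _ ho.isVertex_dom hrg hle, hl, rfl⟩

end DRObjects

/-! ### Matching objects over `D_R` -/

section Matching

variable {R₀ : Type u} [Category.{v} R₀] {R : Type u'} [Category.{v'} R] {c : R₀ ⥤ R}
  {T : Type*} [Category* T]

open FreeIsoCat

namespace FreeIsoCat

lemma identities_comp_iff (hR₀ : IsDirectCategory R₀) (hR : IsGeneralizedDirectCategory R)
    (hc : c.ReflectsIsomorphisms) {a b d : FreeIsoCat c} (f : a ⟶ b) (g : b ⟶ d) :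
    MorphismProperty.identities _ (f ≫ g) ↔
      MorphismProperty.identities _ f ∧ MorphismProperty.identities _ g := by
  obtain ⟨N, hN, hN₀⟩ := exists_length hR₀ hR hc
  rw [← hN₀, ← hN₀, ← hN₀, hN, Nat.add_eq_zero_iff]

end FreeIsoCat

namespace DR

/-- The morphism of `D_R` given by a factorization of its target through its source. -/
def homMk {f d : DR c} (u : d.obj.dom ⟶ f.obj.dom) (v : f.obj.cod ⟶ d.obj.cod)
    (w : u ≫ f.obj.arr ≫ v = d.obj.arr) : f ⟶ d :=
  ObjectProperty.homMk (TwistedArrow.Hom.mk u v w)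

lemma hom_ext {f d : DR c} {m m' : f ⟶ d} (h : m.hom.left = m'.hom.left)
    (h' : m.hom.right = m'.hom.right) : m = m' :=
  ObjectProperty.hom_ext _ (TwistedArrow.Hom.ext h h')

lemma identities_iff {f d : DR c} (m : f ⟶ d) : MorphismProperty.identities _ m ↔
    MorphismProperty.identities _ m.hom.left ∧ MorphismProperty.identities _ m.hom.right := by
  constructor
  · rintro ⟨⟩
    exact ⟨⟨_⟩, ⟨_⟩⟩
  · obtain ⟨⟨a, b, f⟩, hf⟩ := f
    obtain ⟨⟨a', b', d⟩, hd⟩ := d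
    obtain ⟨⟨u, v, w⟩⟩ := m
    rintro ⟨hu, hv⟩
    dsimp at u v w hu hv
    obtain ⟨⟩ := hu
    obtain ⟨⟩ := hv
    obtain rfl : f = d := by simpa using w
    exact ⟨_⟩

/-- The identity of a vertex, as an object of `D_R`. -/
abbrev vertex (a : FreeIsoCat c) (ha : IsVertex a) : DR c := ⟨⟨a, a, 𝟙 a⟩, ha.isDRObject_id⟩

variable {F : Rᵒᵖ ⥤ T} {d : DR c} (s : Cone (matchingDiagram ((DR.proj c).op ⋙ F) d))

/-- The leg of a cone over the matching diagram of `p^* F` at a non-identity arrow `m`. -/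
def leg {f : DR c} (m : f ⟶ d) (hm : ¬ MorphismProperty.identities _ m) :
    s.pt ⟶ F.obj (op ((toBase c).obj f.obj.cod)) :=
  s.π.app (op ⟨Over.mk m, hm⟩)

lemma leg_comp {f f' : DR c} (n : f' ⟶ f) {m : f ⟶ d} {m' : f' ⟶ d}
    (hm : ¬ MorphismProperty.identities _ m) (hm' : ¬ MorphismProperty.identities _ m')
    (h : n ≫ m = m') :
    leg s m hm ≫ F.map ((toBase c).map n.hom.right).op = leg s m' hm' :=
  s.w (j := op ⟨Over.mk m, hm⟩) (j' := op ⟨Over.mk m', hm'⟩)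
    (Quiver.Hom.op (ObjectProperty.homMk (Over.homMk n h)))

lemma not_identities_homMk (hd : ¬ MorphismProperty.identities _ d.obj.arr)
    {b : FreeIsoCat c} (hb : IsVertex b) (u : d.obj.dom ⟶ b) (v : b ⟶ d.obj.cod) (w : u ≫ v = d.obj.arr) :
    ¬ MorphismProperty.identities _
      (homMk (f := vertex b hb) u v ((congrArg (u ≫ ·) (Category.id_comp v)).trans w)) := by
  rw [identities_iff]
  rintro ⟨hu, hv⟩
  exact hd (w ▸ (MorphismProperty.identities _).comp_mem _ _ hu hv)

variable (hd : ¬ MorphismProperty.identities _ d.obj.arr)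

/-- The leg at a factorization of `d` through a vertex. -/
def vertexLeg {b : FreeIsoCat c} (hb : IsVertex b) (u : d.obj.dom ⟶ b)
    (v : b ⟶ d.obj.cod) (w : u ≫ v = d.obj.arr) : s.pt ⟶ F.obj (op ((toBase c).obj b)) :=
  leg s (f := vertex b hb) _ (not_identities_homMk hd hb u v w)

lemma leg_eq_vertexLeg {f : DR c} (m : f ⟶ d) (hm : ¬ MorphismProperty.identities _ m)
    (hf : IsVertex f.obj.cod) :
    leg s m hm = vertexLeg s hd hf (m.hom.left ≫ f.obj.arr) m.hom.right
      ((Category.assoc _ _ _).trans m.hom.w) := by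
  have := leg_comp s (f' := vertex f.obj.cod hf)
    (homMk f.obj.arr (𝟙 _) (by simp)) hm
    (not_identities_homMk hd hf _ _ ((Category.assoc _ _ _).trans m.hom.w))
    (hom_ext rfl (Category.id_comp _))
  refine Eq.trans ?_ this
  refine (Category.comp_id _).symm.trans (congrArg (leg s m hm ≫ ·) ?_)
  refine Eq.symm ((congrArg (fun t => F.map (Quiver.Hom.op t)) ((toBase c).map_id _)).trans ?_)
  exact F.map_id _

lemma vertexLeg_step {b b' : FreeIsoCat c} (hb : IsVertex b) (hb' : IsVertex b')
    (u : d.obj.dom ⟶ b) (g : b ⟶ b') (v : b' ⟶ d.obj.cod) (hg : IsDRObject c ⟨b, b', g⟩)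
    (w : u ≫ g ≫ v = d.obj.arr)
    (huv : ¬ (MorphismProperty.identities _ u ∧ MorphismProperty.identities _ v)) :
    vertexLeg s hd hb u (g ≫ v) w =
      vertexLeg s hd hb' (u ≫ g) v ((Category.assoc _ _ _).trans w) ≫
        F.map ((toBase c).map g).op := by
  let o : DR c := ⟨⟨b, b', g⟩, hg⟩
  let m : o ⟶ d := homMk u v w
  have hm : ¬ MorphismProperty.identities _ m := fun h => huv ((identities_iff m).1 h)
  have h₁ := leg_comp s (f' := vertex b hb) (homMk (d := o) (𝟙 b) g (by simp [o])) hm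
    (not_identities_homMk hd hb u (g ≫ v) w) (hom_ext (Category.comp_id _) rfl)
  rw [leg_eq_vertexLeg s hd m hm hb'] at h₁
  exact h₁.symm

/-- The legs of a cone at two factorizations of `d` through vertices are compatible, unless one of
them is through the source and the other through the target. -/
lemma vertexLeg_comp (hR₀ : IsDirectCategory R₀) (hR : IsGeneralizedDirectCategory R)
    (hc : c.ReflectsIsomorphisms) {b b' : FreeIsoCat c} (hb : IsVertex b) (hb' : IsVertex b')
    (u : d.obj.dom ⟶ b) (g : b ⟶ b') (v : b' ⟶ d.obj.cod) (w : u ≫ g ≫ v = d.obj.arr)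
    (huv : ¬ (MorphismProperty.identities _ u ∧ MorphismProperty.identities _ v)) :
    vertexLeg s hd hb u (g ≫ v) w =
      vertexLeg s hd hb' (u ≫ g) v ((Category.assoc _ _ _).trans w) ≫
        F.map ((toBase c).map g).op := by
  have hN := fun {a b d : FreeIsoCat c} (f : a ⟶ b) (g : b ⟶ d) =>
    identities_comp_iff hR₀ hR hc f g
  revert hb' v w huv
  refine induction_append (P := fun {b'} g => ∀ (hb' : IsVertex b') (v : b' ⟶ d.obj.cod)
    (w : u ≫ g ≫ v = d.obj.arr)
    (_ : ¬ (MorphismProperty.identities _ u ∧ MorphismProperty.identities _ v)),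
    vertexLeg s hd hb u (g ≫ v) w =
      vertexLeg s hd hb' (u ≫ g) v ((Category.assoc _ _ _).trans w) ≫
        F.map ((toBase c).map g).op) ?_ ?_ g
  · intro hb' v w huv
    have h : F.map ((toBase c).map (𝟙 b)).op = 𝟙 _ :=
      (congrArg (fun t => F.map (Quiver.Hom.op t)) ((toBase c).map_id _)).trans (F.map_id _)
    rw [h, Category.comp_id]
    congr 1 <;> simp
  · intro m b' g l ih hb' v w huv
    have w' : u ≫ g ≫ letter l ≫ v = d.obj.arr := by simpa using w
    have hle : freeLength (u ≫ g ≫ letter l ≫ v) ≤ 1 := w' ▸ d.property.freeLength_le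
    have hm : IsVertex m := by
      by_cases hl : MorphismProperty.identities _ (letter l)
      · exact hb'.of_identities hl
      · refine isVertex_of_comp (u ≫ g) (letter l ≫ v) d.property.isVertex_dom
          (fun h => hl ((hN _ _).1 h).1) ?_
        rwa [Category.assoc]
    have hl : IsDRObject c ⟨m, ofObj c b', letter l⟩ := .of_letter l hm (by
      simp only [freeLength_comp] at hle
      omega)
    have h₁ := ih hm (letter l ≫ v) w' (fun h => huv ⟨h.1, ((hN _ _).1 h.2).2⟩)
    have h₂ := vertexLeg_step s hd hm hb' (u ≫ g) (letter l) v hl (by simpa using w)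
      (fun h => huv ⟨((hN _ _).1 h.1).1, h.2⟩)
    rw [h₂] at h₁
    have h : F.map ((toBase c).map (g ≫ letter l)).op =
        F.map ((toBase c).map (letter l)).op ≫ F.map ((toBase c).map g).op := by
      rw [(toBase c).map_comp, op_comp, F.map_comp]
    rw [h, ← Category.assoc]
    convert h₁ using 2 <;> simp

end DR

end Matching

section MatchingObjects

variable {R₀ : Type u} [Category.{v} R₀] {R : Type u'} [Category.{v'} R] {c : R₀ ⥤ R}
  {T : Type*} [Category* T]

open FreeIsoCat

namespace DR

variable {F : Rᵒᵖ ⥤ T} {d : DR c}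

lemma map_toBase_id (b : FreeIsoCat c) : F.map ((toBase c).map (𝟙 b)).op = 𝟙 _ :=
  (congrArg (fun t => F.map (Quiver.Hom.op t)) ((toBase c).map_id _)).trans (F.map_id _)

lemma map_toBase_comp {a b d : FreeIsoCat c} (f : a ⟶ b) (g : b ⟶ d) :
    F.map ((toBase c).map (f ≫ g)).op =
      F.map ((toBase c).map g).op ≫ F.map ((toBase c).map f).op := by
  rw [(toBase c).map_comp, op_comp, F.map_comp]

lemma isIso_map_toBase_letter {a : FreeIsoCat c} {b : R} (l : baseObj a ⟶ b) (hl : IsIso l) :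
    IsIso (F.map ((toBase c).map (letter l)).op) := by
  have : IsIso ((toBase c).map (letter l)) := (toBase_map_letter l).symm ▸ hl
  infer_instance

/-- If some `X(m₀)` is a monomorphism, then for the tautological cone to be a matching object it is
enough that every cone factors through it. -/
lemma nonempty_isLimit_matchingCone {f₀ : DR c} (m₀ : f₀ ⟶ d)
    (hm₀ : ¬ MorphismProperty.identities _ m₀)
    (hmono : Mono (F.map ((toBase c).map m₀.hom.right).op))
    (h : ∀ s : Cone (matchingDiagram ((DR.proj c).op ⋙ F) d),
      ∃ τ : s.pt ⟶ F.obj (op ((toBase c).obj d.obj.cod)), ∀ {f : DR c} (m : f ⟶ d)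
        (hm : ¬ MorphismProperty.identities _ m),
        leg s m hm = τ ≫ F.map ((toBase c).map m.hom.right).op) :
    Nonempty (IsLimit (matchingCone ((DR.proj c).op ⋙ F) d)) := by
  choose τ hτ using h
  refine ⟨{ lift := τ, fac := fun s j => (hτ s j.unop.obj.hom j.unop.property).symm,
            uniq := fun s t ht => ?_ }⟩
  exact (cancel_mono (F.map ((toBase c).map m₀.hom.right).op)).1
    ((ht (op ⟨Over.mk m₀, hm₀⟩)).trans (hτ s m₀ hm₀))

/-- The matching object is trivial at a decomposable arrow between vertices. -/
lemma nonempty_isLimit_of_decomposable (hR₀ : IsDirectCategory R₀)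
    (hR : IsGeneralizedDirectCategory R) (hc : c.ReflectsIsomorphisms)
    (hcod : IsVertex d.obj.cod) {b : FreeIsoCat c} (g₁ : d.obj.dom ⟶ b) (g₂ : b ⟶ d.obj.cod)
    (h : g₁ ≫ g₂ = d.obj.arr) (h₁ : ¬ MorphismProperty.identities _ g₁)
    (h₂ : ¬ MorphismProperty.identities _ g₂) :
    Nonempty (IsLimit (matchingCone ((DR.proj c).op ⋙ F) d)) := by
  have hd : ¬ MorphismProperty.identities _ d.obj.arr := fun hd =>
    h₁ ((identities_comp_iff hR₀ hR hc _ _).1 (h ▸ hd)).1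
  have hle := d.property.freeLength_le
  have hdom := d.property.isVertex_dom
  have hb : IsVertex b := isVertex_of_comp g₁ g₂ hdom h₂ (h ▸ hle)
  refine nonempty_isLimit_matchingCone _
    (not_identities_homMk hd hcod d.obj.arr (𝟙 _) (Category.comp_id _)) ?_ fun s => ?_
  · change Mono (F.map ((toBase c).map (𝟙 d.obj.cod)).op)
    rw [map_toBase_id]
    infer_instance
  · have key : ∀ {e : FreeIsoCat c} (he : IsVertex e) (w : d.obj.dom ⟶ e) (v : e ⟶ d.obj.cod)
        (hwv : w ≫ v = d.obj.arr), vertexLeg s hd he w v hwv =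
          vertexLeg s hd hcod d.obj.arr (𝟙 _) (Category.comp_id _) ≫
            F.map ((toBase c).map v).op := by
      intro e he w v hwv
      by_cases hw : MorphismProperty.identities _ w
      · -- the two legs are compared through the leg at the given decomposition
        obtain ⟨⟩ := hw
        obtain rfl : g₁ ≫ g₂ = v := by rw [h, ← hwv, Category.id_comp]
        have e₁ := vertexLeg_comp s hd hR₀ hR hc he hb (𝟙 _) g₁ g₂ hwv (fun t => h₂ t.2)
        have e₂ := vertexLeg_comp s hd hR₀ hR hc hb hcod g₁ g₂ (𝟙 _) (by simpa using h)
          (fun t => h₁ t.1)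
        simp only [Category.id_comp] at e₁
        simp only [Category.comp_id] at e₂
        rw [e₁, e₂, map_toBase_comp, Category.assoc]
        simp only [h]
      · have e₁ := vertexLeg_comp s hd hR₀ hR hc he hcod w v (𝟙 _) (by simpa using hwv)
          (fun t => hw t.1)
        simp only [Category.comp_id, hwv] at e₁
        exact e₁
    refine ⟨vertexLeg s hd hcod d.obj.arr (𝟙 _) (Category.comp_id _), fun {f} m hm => ?_⟩
    have hf : IsVertex f.obj.cod := by
      by_cases hv : MorphismProperty.identities _ m.hom.right
      · exact hcod.of_identities hv
      · refine isVertex_of_comp (m.hom.left ≫ f.obj.arr) m.hom.right hdom hv ?_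
        rw [Category.assoc, m.hom.w]
        exact hle
    rw [leg_eq_vertexLeg s hd m hm hf]
    exact key hf _ _ _

/-- The matching object is trivial at an arrow whose target is not a vertex. -/
lemma nonempty_isLimit_of_not_isVertex (hR₀ : IsDirectCategory R₀)
    (hR : IsGeneralizedDirectCategory R) (hc : c.ReflectsIsomorphisms)
    (hcod : ¬ IsVertex d.obj.cod) :
    Nonempty (IsLimit (matchingCone ((DR.proj c).op ⋙ F) d)) := by
  have hle := d.property.freeLength_le
  have hdom := d.property.isVertex_dom
  have hd : ¬ MorphismProperty.identities _ d.obj.arr := fun hd => hcod (hdom.target hd)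
  obtain ⟨m₀, q, l, hql, hm₀, hq, hl, hl'⟩ := exists_last_letter _ hdom hcod hle
  have hiso : IsIso (F.map ((toBase c).map (letter l)).op) := isIso_map_toBase_letter l hl'
  refine nonempty_isLimit_matchingCone _
    (not_identities_homMk hd hm₀ q (letter l) hql.symm) ?_ fun s => ?_
  · exact (inferInstance : Mono (F.map ((toBase c).map (letter l)).op))
  · have key : ∀ {e : FreeIsoCat c} (he : IsVertex e) (w : d.obj.dom ⟶ e) (v : e ⟶ d.obj.cod)
        (hwv : w ≫ v = d.obj.arr), vertexLeg s hd he w v hwv =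
          (vertexLeg s hd hm₀ q (letter l) hql.symm ≫ inv (F.map ((toBase c).map (letter l)).op)) ≫
            F.map ((toBase c).map v).op := by
      intro e he w v hwv
      have hle' := hle
      rw [← hwv, freeLength_comp] at hle'
      obtain ⟨m₁, q₁, l₁, rfl, hm₁, hq₁, hl₁, -⟩ := exists_last_letter v he hcod (by omega)
      have hl₁' := hl₁
      rw [← freeLength_letter_eq_zero_iff] at hl₁'
      rw [freeLength_comp] at hle'
      obtain ⟨rfl, h₁, h₂⟩ := cancel_letter (f := w ≫ q₁) (f' := q)
        (by rw [freeLength_comp]; omega) hq hl₁ hl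
        (by rw [Category.assoc, hwv, hql])
      obtain rfl := eq_of_heq h₁
      obtain rfl := eq_of_heq h₂
      have e₁ := vertexLeg_comp s hd hR₀ hR hc he hm₁ w q₁ (letter l₁) hwv
        (fun t => not_identities_letter hl₁ t.2)
      rw [e₁, map_toBase_comp]
      simp
    refine ⟨vertexLeg s hd hm₀ q (letter l) hql.symm ≫ inv (F.map ((toBase c).map (letter l)).op),
      fun {f} m hm => ?_⟩
    by_cases hf : IsVertex f.obj.cod
    · rw [leg_eq_vertexLeg s hd m hm hf]
      exact key hf _ _ _
    · have hv : MorphismProperty.identities _ m.hom.right := by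
        by_contra hv
        refine hf (isVertex_of_comp (m.hom.left ≫ f.obj.arr) m.hom.right hdom hv ?_)
        rw [Category.assoc, m.hom.w]
        exact hle
      have hflen := f.property.freeLength_le
      have hfdom := f.property.isVertex_dom
      obtain ⟨⟨a, b, arr⟩, hfp⟩ := f
      obtain ⟨⟨u, v, w⟩⟩ := m
      dsimp at u v w hf hflen hfdom hv
      obtain ⟨⟩ := hv
      obtain ⟨m₁, q₁, l₁, rfl, hm₁, hq₁, hl₁, -⟩ := exists_last_letter arr hfdom hcod hflen
      have hl₁' := hl₁
      rw [← freeLength_letter_eq_zero_iff] at hl₁'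
      have w' : (u ≫ q₁) ≫ letter l₁ = d.obj.arr := by simpa using w
      have hle' := hle
      rw [← w', freeLength_comp] at hle'
      obtain ⟨rfl, h₁, h₂⟩ := cancel_letter (f := u ≫ q₁) (f' := q)
        (by omega) hq hl₁ hl (by rw [w', hql])
      obtain rfl := eq_of_heq h₁
      obtain rfl := eq_of_heq h₂
      have e₁ := leg_comp s (f' := vertex m₁ hm₁) (f := ⟨⟨a, _, q₁ ≫ letter l₁⟩, hfp⟩)
        (homMk q₁ (letter l₁) (by simp)) hm
        (not_identities_homMk hd hm₁ (u ≫ q₁) (letter l₁) w')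
        (hom_ext rfl (Category.comp_id _))
      have e₂ : vertexLeg s hd hm₁ (u ≫ q₁) (letter l₁) w' =
        leg s _ hm ≫ F.map ((toBase c).map (letter l₁)).op := e₁.symm
      rw [e₂]
      refine Eq.symm ((congrArg (_ ≫ ·) (map_toBase_id _)).trans ?_)
      simp

end DR

end MatchingObjects

section MatchingObjects

variable {R₀ : Type u} [Category.{v} R₀] {R : Type u'} [Category.{v'} R] {c : R₀ ⥤ R}
  {T : Type*} [Category* T]

open FreeIsoCat

namespace DR

variable {F : Rᵒᵖ ⥤ T} {d : DR c}

/-- There are no non-identity arrows to an identity. -/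
lemma isEmpty_latching (hR₀ : IsDirectCategory R₀) (hR : IsGeneralizedDirectCategory R)
    (hc : c.ReflectsIsomorphisms) (hd : MorphismProperty.identities _ d.obj.arr) :
    IsEmpty (latchingProperty d).FullSubcategory := by
  refine ⟨fun e => e.property ((identities_iff e.obj.hom).2 ?_)⟩
  rw [← e.obj.hom.hom.w, identities_comp_iff hR₀ hR hc, identities_comp_iff hR₀ hR hc] at hd
  exact ⟨hd.1, hd.2.2⟩

variable [HasBinaryProducts T]

open Classical in
/-- If `d : x ⟶ y` is indecomposable, the only non-identity arrows to `d` are from the identities of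
`x` and `y`, so the matching object of `p^* F` is a product; this is its leg at `m`. -/
noncomputable def pairLeg (F : Rᵒᵖ ⥤ T) {f d : DR c} (m : f ⟶ d) :
    F.obj (op ((toBase c).obj d.obj.dom)) ⨯ F.obj (op ((toBase c).obj d.obj.cod)) ⟶
      F.obj (op ((toBase c).obj f.obj.cod)) :=
  if h : MorphismProperty.identities _ (m.hom.left ≫ f.obj.arr) then
    have := isIso_of_identities h
    prod.fst ≫ F.map ((toBase c).map (inv (m.hom.left ≫ f.obj.arr))).op
  else prod.snd ≫ F.map ((toBase c).map m.hom.right).op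

lemma pairLeg_of_identities {f d : DR c} (m : f ⟶ d)
    (h : MorphismProperty.identities _ (m.hom.left ≫ f.obj.arr)) (r : f.obj.cod ⟶ d.obj.dom)
    (hr : (m.hom.left ≫ f.obj.arr) ≫ r = 𝟙 _) :
    pairLeg F m = prod.fst ≫ F.map ((toBase c).map r).op := by
  have := isIso_of_identities h
  rw [pairLeg, dif_pos h]
  simp only [IsIso.inv_eq_of_hom_inv_id hr]

lemma pairLeg_of_not_identities {f d : DR c} (m : f ⟶ d)
    (h : ¬ MorphismProperty.identities _ (m.hom.left ≫ f.obj.arr)) :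
    pairLeg F m = prod.snd ≫ F.map ((toBase c).map m.hom.right).op :=
  dif_neg h

/-- The matching map at an indecomposable arrow between vertices is the graph of a restriction
map. -/
lemma exists_matching_of_indecomposable (hR₀ : IsDirectCategory R₀)
    (hR : IsGeneralizedDirectCategory R) (hc : c.ReflectsIsomorphisms)
    (hcod : IsVertex d.obj.cod) (hd : ¬ MorphismProperty.identities _ d.obj.arr)
    (hind : ∀ {m : FreeIsoCat c} (f : d.obj.dom ⟶ m) (g : m ⟶ d.obj.cod), f ≫ g = d.obj.arr →
      MorphismProperty.identities _ f ∨ MorphismProperty.identities _ g) :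
    ∃ (M : Cone (matchingDiagram ((DR.proj c).op ⋙ F) d)) (hM : IsLimit M)
      (e : M.pt ≅ F.obj (op ((toBase c).obj d.obj.dom)) ⨯ F.obj (op ((toBase c).obj d.obj.cod))),
      hM.lift (matchingCone ((DR.proj c).op ⋙ F) d) ≫ e.hom =
        prod.lift (F.map ((toBase c).map d.obj.arr).op) (𝟙 _) := by
  have hN := fun {a b d : FreeIsoCat c} (f : a ⟶ b) (g : b ⟶ d) =>
    identities_comp_iff hR₀ hR hc f g
  have hdom := d.property.isVertex_dom
  have hw : ∀ {f : DR c} (m : f ⟶ d), (m.hom.left ≫ f.obj.arr) ≫ m.hom.right = d.obj.arr :=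
    fun m => (Category.assoc _ _ _).trans m.hom.w
  have nat : ∀ {f f' : DR c} (n : f' ⟶ f) (m : f ⟶ d) (m' : f' ⟶ d)
      (_ : ¬ MorphismProperty.identities _ m) (_ : n ≫ m = m'),
      pairLeg F m' = pairLeg F m ≫ F.map ((toBase c).map n.hom.right).op := by
    rintro f f' n m _ hm rfl
    have e : (m.hom.left ≫ n.hom.left ≫ f'.obj.arr) ≫ n.hom.right = m.hom.left ≫ f.obj.arr := by
      rw [← n.hom.w]; simp
    have e' : (n ≫ m).hom.left ≫ f'.obj.arr = m.hom.left ≫ n.hom.left ≫ f'.obj.arr :=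
      Category.assoc _ _ _
    by_cases h : MorphismProperty.identities _ (m.hom.left ≫ f.obj.arr)
    · have h' : MorphismProperty.identities _ ((n ≫ m).hom.left ≫ f'.obj.arr) := by
        rw [← e, hN] at h
        rw [e']
        exact h.1
      have := isIso_of_identities h
      rw [pairLeg_of_identities m h _ (IsIso.hom_inv_id _),
        pairLeg_of_identities (n ≫ m) h' (n.hom.right ≫ inv (m.hom.left ≫ f.obj.arr))
          (by rw [e', ← Category.assoc, e, IsIso.hom_inv_id]), map_toBase_comp, Category.assoc]
    · have h' : ¬ MorphismProperty.identities _ ((n ≫ m).hom.left ≫ f'.obj.arr) := fun h' => by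
        rw [e', hN, hN] at h'
        exact hm ((identities_iff m).2 ⟨h'.1, (hind _ _ (hw m)).resolve_left h⟩)
      rw [pairLeg_of_not_identities m h, pairLeg_of_not_identities _ h', Category.assoc,
        ← map_toBase_comp]
      rfl
  let M : Cone (matchingDiagram ((DR.proj c).op ⋙ F) d) :=
    { pt := F.obj (op ((toBase c).obj d.obj.dom)) ⨯ F.obj (op ((toBase c).obj d.obj.cod))
      π := { app := fun j => pairLeg F j.unop.obj.hom
             naturality := fun j j' t => (Category.id_comp _).trans
               (nat t.unop.hom.left _ _ j.unop.property (Over.w t.unop.hom)) } }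
  -- the legs at the identities of the source and of the target of `d`
  have hsrc := not_identities_homMk hd hdom (𝟙 _) d.obj.arr (Category.id_comp _)
  have htgt := not_identities_homMk hd hcod d.obj.arr (𝟙 _) (Category.comp_id _)
  have hsrc' : leg M _ hsrc = prod.fst := by
    refine (pairLeg_of_identities _ ?_ (𝟙 _) ?_).trans ?_
    · exact (identities_iff_eq_id _).2 (Category.comp_id _)
    · exact (Category.comp_id _).trans (Category.comp_id _)
    · exact (congrArg (prod.fst ≫ ·) (map_toBase_id _)).trans (Category.comp_id _)
  have htgt' : leg M _ htgt = prod.snd := by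
    refine (pairLeg_of_not_identities _ ?_).trans ?_
    · exact fun h => hd ((hN _ _).1 h).1
    · exact (congrArg (prod.snd ≫ ·) (map_toBase_id _)).trans (Category.comp_id _)
  have fac : ∀ (s : Cone (matchingDiagram ((DR.proj c).op ⋙ F) d)) {f : DR c} (m : f ⟶ d)
      (hm : ¬ MorphismProperty.identities _ m),
      prod.lift (vertexLeg s hd hdom (𝟙 _) d.obj.arr (Category.id_comp _))
        (vertexLeg s hd hcod d.obj.arr (𝟙 _) (Category.comp_id _)) ≫ pairLeg F m =
          leg s m hm := by
    intro s f m hm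
    have key₁ : ∀ {e : FreeIsoCat c} (he : IsVertex e) (w : d.obj.dom ⟶ e) (v : e ⟶ d.obj.cod)
        (hwv : w ≫ v = d.obj.arr) (_ : MorphismProperty.identities _ w) (r : e ⟶ d.obj.dom)
        (_ : w ≫ r = 𝟙 _), vertexLeg s hd he w v hwv =
          vertexLeg s hd hdom (𝟙 _) d.obj.arr (Category.id_comp _) ≫
            F.map ((toBase c).map r).op := by
      rintro _ he w v hwv ⟨⟩ r hr
      obtain rfl : r = 𝟙 _ := by rw [← hr, Category.id_comp]
      obtain rfl : v = d.obj.arr := by rw [← hwv, Category.id_comp]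
      rw [map_toBase_id, Category.comp_id]
    have key₂ : ∀ {e : FreeIsoCat c} (he : IsVertex e) (w : d.obj.dom ⟶ e) (v : e ⟶ d.obj.cod)
        (hwv : w ≫ v = d.obj.arr) (_ : MorphismProperty.identities _ v), vertexLeg s hd he w v hwv =
          vertexLeg s hd hcod d.obj.arr (𝟙 _) (Category.comp_id _) ≫
            F.map ((toBase c).map v).op := by
      rintro _ he w v hwv ⟨⟩
      obtain rfl : w = d.obj.arr := by rw [← hwv, Category.comp_id]
      rw [map_toBase_id, Category.comp_id]
    by_cases h : MorphismProperty.identities _ (m.hom.left ≫ f.obj.arr)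
    · have := isIso_of_identities h
      rw [pairLeg_of_identities m h _ (IsIso.hom_inv_id _), prod.lift_fst_assoc,
        leg_eq_vertexLeg s hd m hm (hdom.target h)]
      exact (key₁ _ _ _ (hw m) h _ (IsIso.hom_inv_id _)).symm
    · have hv := (hind _ _ (hw m)).resolve_left h
      rw [pairLeg_of_not_identities m h, prod.lift_snd_assoc,
        leg_eq_vertexLeg s hd m hm (hcod.of_identities hv)]
      exact (key₂ _ _ _ (hw m) hv).symm
  refine ⟨M, { lift := fun s => prod.lift
                (vertexLeg s hd hdom (𝟙 _) d.obj.arr (Category.id_comp _))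
                (vertexLeg s hd hcod d.obj.arr (𝟙 _) (Category.comp_id _))
               fac := fun s j => fac s j.unop.obj.hom j.unop.property
               uniq := fun s t ht => ?_ }, Iso.refl _, ?_⟩
  · refine prod.hom_ext ?_ ?_
    · rw [prod.lift_fst, ← hsrc']
      exact ht (op ⟨Over.mk _, hsrc⟩)
    · rw [prod.lift_snd, ← htgt']
      exact ht (op ⟨Over.mk _, htgt⟩)
  · refine (Category.comp_id _).trans (congrArg₂ prod.lift rfl ?_)
    exact map_toBase_id _

end DR

end MatchingObjects

/-! ### Frames, levelwise -/

section Reedy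

variable {D : Type u} [Category.{v} D] {T : Type u'} [Category.{v'} T] {X Y : Dᵒᵖ ⥤ T}
  (m : X ⟶ Y) {d : D} {M : Cone (matchingDiagram X d)} (hM : IsLimit M)
  {N : Cone (matchingDiagram Y d)} (hN : IsLimit N)

lemma lift_matchingCone_naturality :
    hM.lift (matchingCone X d) ≫ hN.map M (matchingDiagramMap m d) =
      m.app (op d) ≫ hN.lift (matchingCone Y d) := by
  refine hN.hom_ext fun j => ?_
  have h₁ : (hM.lift (matchingCone X d) ≫ hN.map M (matchingDiagramMap m d)) ≫ N.π.app j =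
      X.map j.unop.obj.hom.op ≫ m.app (op j.unop.obj.left) := by
    rw [Category.assoc, IsLimit.map_π, ← Category.assoc, hM.fac]
    rfl
  have h₂ : m.app (op d) ≫ hN.lift (matchingCone Y d) ≫ N.π.app j =
      m.app (op d) ≫ Y.map j.unop.obj.hom.op := congrArg (_ ≫ ·) (hN.fac (matchingCone Y d) j)
  exact h₁.trans ((m.naturality j.unop.obj.hom.op).trans
    (h₂.symm.trans (Category.assoc _ _ _).symm))

lemma exists_relativeMatching_of_isIso {fib : MorphismProperty T}
    [IsIso (hN.map M (matchingDiagramMap m d))] (h : fib (m.app (op d))) :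
    ∃ (P : T) (a : P ⟶ M.pt) (b : P ⟶ Y.obj (op d)) (l : X.obj (op d) ⟶ P),
      IsPullback a b (hN.map M (matchingDiagramMap m d)) (hN.lift (matchingCone Y d)) ∧
      l ≫ a = hM.lift (matchingCone X d) ∧ l ≫ b = m.app (op d) ∧ fib l := by
  let t : Y.obj (op d) ⟶ N.pt := hN.lift (matchingCone Y d)
  have ht : m.app (op d) ≫ t = hM.lift (matchingCone X d) ≫ hN.map M (matchingDiagramMap m d) :=
    (lift_matchingCone_naturality m hM hN).symm
  have sq : IsPullback (t ≫ inv (hN.map M (matchingDiagramMap m d))) (𝟙 (Y.obj (op d)))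
      (hN.map M (matchingDiagramMap m d)) t := IsPullback.of_vert_isIso ⟨by simp⟩
  refine ⟨Y.obj (op d), _, 𝟙 _, m.app (op d), sq, ?_, Category.comp_id _, h⟩
  refine (Category.assoc _ _ _).symm.trans ((congrArg (· ≫ inv _) ht).trans ?_)
  exact (Category.assoc _ _ _).trans ((congrArg (_ ≫ ·) (IsIso.hom_inv_id _)).trans
    (Category.comp_id _))

lemma exists_relativeMatching_of_mono {fib : MorphismProperty T} (hT : IsTribe fib)
    [Mono (hN.lift (matchingCone Y d))] (h : fib (hM.lift (matchingCone X d)))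
    (h' : fib (hN.lift (matchingCone Y d))) :
    ∃ (P : T) (a : P ⟶ M.pt) (b : P ⟶ Y.obj (op d)) (l : X.obj (op d) ⟶ P),
      IsPullback a b (hN.map M (matchingDiagramMap m d)) (hN.lift (matchingCone Y d)) ∧
      l ≫ a = hM.lift (matchingCone X d) ∧ l ≫ b = m.app (op d) ∧ fib l := by
  obtain ⟨P, p, q, sq⟩ := hT.exists_isPullback (hN.map M (matchingDiagramMap m d)) _ h'
  have e := sq.lift_fst _ _ (lift_matchingCone_naturality m hM hN)
  have : Mono p := MorphismProperty.of_isPullback (P := .monomorphisms T) sq.flip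
    (.infer_property (hN.lift (matchingCone Y d)))
  exact ⟨P, p, q, _, sq, e, sq.lift_snd _ _ (lift_matchingCone_naturality m hM hN),
    hT.fib_of_mono _ p (Eq.mpr (congrArg (fun t => fib t) e) h)⟩

end Reedy

section FramesLevelwise

variable {R₀ : Type u} [Category.{v} R₀] {R : Type u'} [Category.{v'} R] {c : R₀ ⥤ R}
  {T : Type*} [Category* T] {fib : MorphismProperty T}

open FreeIsoCat DR

/-- If `d` is not an identity of `F_≃(R)`, there is a non-identity arrow `m` of `D_R` with target `d`
which every `p^* F` inverts. -/
lemma DR.exists_isIso_map {d : DR c} (F : Rᵒᵖ ⥤ T)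
    (hd : ¬ MorphismProperty.identities _ d.obj.arr) :
    ∃ (f : DR c) (m : f ⟶ d), ¬ MorphismProperty.identities _ m ∧
      IsIso (F.map ((toBase c).map m.hom.right).op) := by
  by_cases hcod : IsVertex d.obj.cod
  · refine ⟨_, _, not_identities_homMk hd hcod d.obj.arr (𝟙 _) (Category.comp_id _), ?_⟩
    change IsIso (F.map ((toBase c).map (𝟙 d.obj.cod)).op)
    rw [map_toBase_id]
    infer_instance
  · obtain ⟨m, q, l, h, hm, -, -, hl⟩ :=
      exists_last_letter d.obj.arr d.property.isVertex_dom hcod d.property.freeLength_le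
    exact ⟨_, _, not_identities_homMk hd hm q (letter l) h.symm, isIso_map_toBase_letter l hl⟩

/-- The matching maps of `p^* F` at arrows that are not identities are monomorphisms. -/
lemma DR.mono_matching {d : DR c} {F : Rᵒᵖ ⥤ T} (hd : ¬ MorphismProperty.identities _ d.obj.arr)
    {M : Cone (matchingDiagram ((DR.proj c).op ⋙ F) d)} (hM : IsLimit M) :
    Mono (hM.lift (matchingCone ((DR.proj c).op ⋙ F) d)) := by
  obtain ⟨f, m, hm, hiso⟩ := exists_isIso_map F hd
  have h : hM.lift (matchingCone ((DR.proj c).op ⋙ F) d) ≫ leg M m hm =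
      F.map ((toBase c).map m.hom.right).op := hM.fac _ (op ⟨Over.mk m, hm⟩)
  have : Mono (hM.lift (matchingCone ((DR.proj c).op ⋙ F) d) ≫ leg M m hm) := by
    rw [h]
    exact (inferInstance : Mono (F.map ((toBase c).map m.hom.right).op))
  exact mono_of_mono _ (leg M m hm)

/-- The matching object at an identity of `F_≃(R)` is terminal. -/
lemma DR.nonempty_isLimit_of_isTerminal (hR₀ : IsDirectCategory R₀)
    (hR : IsGeneralizedDirectCategory R) (hc : c.ReflectsIsomorphisms) {d : DR c} (F : Rᵒᵖ ⥤ T)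
    (hd : MorphismProperty.identities _ d.obj.arr) {Z : T} (hZ : IsTerminal Z) :
    ∃ M : Cone (matchingDiagram ((DR.proj c).op ⋙ F) d), Nonempty (IsLimit M) ∧ Nonempty (IsTerminal M.pt) := by
  have := isEmpty_latching hR₀ hR hc hd
  exact ⟨⟨Z, { app := fun j => isEmptyElim j.unop, naturality := fun j => isEmptyElim j.unop }⟩,
    ⟨{ lift := fun s => hZ.from _
       fac := fun s j => isEmptyElim j.unop
       uniq := fun s t _ => hZ.hom_ext _ _ }⟩, ⟨hZ⟩⟩

lemma DR.isIso_map_of_identities (hR₀ : IsDirectCategory R₀)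
    (hR : IsGeneralizedDirectCategory R) (hc : c.ReflectsIsomorphisms) {d : DR c} {F G : Rᵒᵖ ⥤ T}
    (hd : MorphismProperty.identities _ d.obj.arr)
    {M : Cone (matchingDiagram ((DR.proj c).op ⋙ F) d)} (hM : IsLimit M)
    {N : Cone (matchingDiagram ((DR.proj c).op ⋙ G) d)} (hN : IsLimit N)
    (α : matchingDiagram ((DR.proj c).op ⋙ F) d ⟶ matchingDiagram ((DR.proj c).op ⋙ G) d) :
    IsIso (hN.map M α) := by
  have := isEmpty_latching hR₀ hR hc hd
  have : ∀ j, IsIso (α.app j) := fun j => isEmptyElim j.unop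
  have : IsIso α := NatIso.isIso_of_isIso_app α
  exact (IsLimit.conePointsIsoOfNatIso hM hN (asIso α)).isIso_hom

/-- The values of a frame at special objects are discrete. -/
lemma IsFrame.isTribeDiscrete [HasBinaryProducts T] (hT : IsTribe fib)
    (hR₀ : IsDirectCategory R₀) (hR : IsGeneralizedDirectCategory R)
    (hc : c.ReflectsIsomorphisms) {F : Rᵒᵖ ⥤ T} (hF : IsFrame c fib F) {a : R}
    (ha : IsSpecial c a) : IsTribeDiscrete fib (F.obj (op a)) := by
  obtain ⟨o, ho, ⟨e⟩, hcod, hid, hind⟩ := ha.exists_indecomposable hR₀ hR hc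
  obtain ⟨M, hM, hfib⟩ := hF.1 ⟨o, ho⟩
  obtain ⟨M', hM', e', he'⟩ :=
    exists_matching_of_indecomposable (F := F) (d := ⟨o, ho⟩) hR₀ hR hc hcod hid hind
  refine IsTribeDiscrete.of_iso hT (IsTribeDiscrete.of_fib_graph hT
    (F.map ((toBase c).map o.arr).op) (hF.2 _) ?_) (F.mapIso e.op.symm)
  rw [← he', ← IsLimit.lift_comp_conePointUniqueUpToIso_hom hM hM']
  exact hT.fib_comp _ _ (hT.fib_comp _ _ hfib (hT.fib_of_isIso _ inferInstance))
    (hT.fib_of_isIso _ inferInstance)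

/-- A homotopical diagram whose values at special objects are discrete is a frame. -/
lemma isFrame_of_isTribeDiscrete [HasBinaryProducts T] (hT : IsTribe fib)
    (hR₀ : IsDirectCategory R₀) (hR : IsGeneralizedDirectCategory R)
    (hc : c.ReflectsIsomorphisms) {F : Rᵒᵖ ⥤ T}
    (hF : ∀ a, IsSpecial c a → IsTribeDiscrete fib (F.obj (op a)))
    (hw : ∀ ⦃x y : Rᵒᵖ⦄ (f : x ⟶ y), IsTribeWeakEquivalence fib (F.map f)) :
    IsFrame c fib F := by
  refine ⟨fun d => ?_, hw⟩
  have triv : Nonempty (IsLimit (matchingCone ((DR.proj c).op ⋙ F) d)) →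
      ∃ (M : Cone (matchingDiagram ((DR.proj c).op ⋙ F) d)) (hM : IsLimit M),
        fib (hM.lift (matchingCone ((DR.proj c).op ⋙ F) d)) := fun ⟨hM⟩ =>
    ⟨_, hM, hT.fib_of_isIso _ (by rw [hM.lift_self]; infer_instance)⟩
  by_cases hd : MorphismProperty.identities _ d.obj.arr
  · have := hT.hasTerminal
    obtain ⟨M, ⟨hM⟩, ⟨h⟩⟩ := nonempty_isLimit_of_isTerminal hR₀ hR hc F hd terminalIsTerminal
    exact ⟨M, hM, by
      rw [h.hom_ext (hM.lift _) (h.from _)]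
      exact hT.fib_toTerminal h⟩
  by_cases hcod : IsVertex d.obj.cod
  · by_cases hind : ∀ {m : FreeIsoCat c} (f : d.obj.dom ⟶ m) (g : m ⟶ d.obj.cod),
      f ≫ g = d.obj.arr →
        MorphismProperty.identities _ f ∨ MorphismProperty.identities _ g
    · obtain ⟨M, hM, e, he⟩ :=
        exists_matching_of_indecomposable (F := F) hR₀ hR hc hcod hd hind
      refine ⟨M, hM, hT.fib_of_mono _ e.hom (Eq.mpr (congrArg (fun t => fib t) he)
        (IsTribeDiscrete.fib_graph hT (hF _ ?_) _))⟩
      exact isSpecial_of_isDRObject d.property hR₀ hc hcod hd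
    · push Not at hind
      obtain ⟨m, f, g, hfg, hf, hg⟩ := hind
      exact triv (nonempty_isLimit_of_decomposable hR₀ hR hc hcod f g hfg hf hg)
  · exact triv (nonempty_isLimit_of_not_isVertex hR₀ hR hc hcod)

lemma map_inv_app_map_hom {F G : Rᵒᵖ ⥤ T} (m : F ⟶ G) {a b : R} (e : a ≅ b) :
    F.map e.inv.op ≫ m.app (op b) ≫ G.map e.hom.op = m.app (op a) := by
  rw [← m.naturality, ← Category.assoc, ← F.map_comp, ← op_comp]
  simp

/-- The `p`-fibrations between frames are the levelwise fibrations. -/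
lemma pFibrations_iff (hT : IsTribe fib)
    (hR₀ : IsDirectCategory R₀) (hR : IsGeneralizedDirectCategory R)
    (hc : c.ReflectsIsomorphisms) (hlift : LiftsArrowsUpToIso c) {F G : Rᵒᵖ ⥤ T}
    (hF : IsFrame c fib F) (hG : IsFrame c fib G) (m : F ⟶ G) :
    pFibrations c fib m ↔ ∀ a, fib (m.app a) := by
  constructor
  · intro hm a
    obtain ⟨x, -, -, e, -, -⟩ := hlift (𝟙 a.unop)
    have hx : IsVertex (ofObj c (c.obj x)) := ⟨x, rfl⟩
    obtain ⟨M, hM, N, hN, P, p, q, l, sq, -, hl, hfib⟩ := hm (vertex _ hx)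
    have := isIso_map_of_identities hR₀ hR hc (F := F) (G := G) ⟨_⟩ hM hN
      (matchingDiagramMap (Functor.whiskerLeft (DR.proj c).op m) (vertex _ hx))
    have hq : IsIso q := sq.isIso_snd_of_isIso
    have hx' : fib (m.app (op (c.obj x))) := by
      have := hT.fib_comp _ _ hfib (hT.fib_of_isIso q hq)
      rw [hl] at this
      exact this
    have h : F.map e.inv.op ≫ m.app (op (c.obj x)) ≫ G.map e.hom.op = m.app a :=
      map_inv_app_map_hom m e
    rw [← h]
    exact hT.fib_comp _ _ (hT.fib_of_isIso _ inferInstance)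
      (hT.fib_comp _ _ hx' (hT.fib_of_isIso _ inferInstance))
  · intro hm d
    obtain ⟨M, hM, hMf⟩ := hF.1 d
    obtain ⟨N, hN, hNf⟩ := hG.1 d
    by_cases hd : MorphismProperty.identities _ d.obj.arr
    · have := isIso_map_of_identities hR₀ hR hc (F := F) (G := G) hd hM hN
        (matchingDiagramMap (Functor.whiskerLeft (DR.proj c).op m) d)
      exact ⟨M, hM, N, hN, exists_relativeMatching_of_isIso _ hM hN (hm _)⟩
    · have := mono_matching (F := G) hd hN
      exact ⟨M, hM, N, hN, exists_relativeMatching_of_mono _ hM hN hT hMf hNf⟩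

end FramesLevelwise

/-! ### Tribes of diagrams -/

section LevelwiseTribe

variable {R : Type u} [Category.{v} R] {T : Type u'} [Category.{v'} T]
  {fib : MorphismProperty T} [HasBinaryProducts T]

/-- Consider a map of cospans of trivial fibrations `x`, `y`, `z`. If `(y, p)` is a fibration, then
so is the gap map of the square `p ≫ z = y ≫ p'`, and the induced map of pullbacks is the composite
of a base change of this gap map and a base change of `x`, hence a weak equivalence. -/
lemma IsTribe.weakEquivalence_pullback (hT : IsTribe fib) {X Y Z P X' Y' Z' P' : T} {a : P ⟶ X}
    {b : P ⟶ Y} {f : X ⟶ Z} {p : Y ⟶ Z} {a' : P' ⟶ X'} {b' : P' ⟶ Y'} {f' : X' ⟶ Z'}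
    {p' : Y' ⟶ Z'} (sq : IsPullback a b f p) (sq' : IsPullback a' b' f' p')
    (x : X ⟶ X') (y : Y ⟶ Y') (z : Z ⟶ Z') (w : P ⟶ P')
    (wf : f ≫ z = x ≫ f') (wp : p ≫ z = y ≫ p') (wa : w ≫ a' = a ≫ x) (wb : w ≫ b' = b ≫ y)
    (hx : fib x) (hz : fib z) (hyp : fib (prod.lift y p))
    (hxw : IsTribeWeakEquivalence fib x) (hyw : IsTribeWeakEquivalence fib y)
    (hzw : IsTribeWeakEquivalence fib z) : IsTribeWeakEquivalence fib w := by
  -- `Q` is the pullback of `z` and `p'`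
  obtain ⟨Q, q₁, q₂, sqQ⟩ := hT.exists_isPullback p' z hz
  have hq₁ : IsTribeWeakEquivalence fib q₁ := hT.weakEquivalence_baseChange sqQ hz hzw
  let g : Y ⟶ Q := sqQ.lift y p wp.symm
  have hgw : IsTribeWeakEquivalence fib g :=
    hT.weakEquivalence_of_comp_right hq₁ (by rwa [sqQ.lift_fst])
  have : Mono (prod.lift q₁ q₂) := ⟨fun u w h => by
    have h₁ := congrArg (· ≫ prod.fst) h
    have h₂ := congrArg (· ≫ prod.snd) h
    simp only [Category.assoc, prod.lift_fst, prod.lift_snd] at h₁ h₂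
    exact sqQ.hom_ext h₁ h₂⟩
  have hg : fib g := hT.fib_of_mono g (prod.lift q₁ q₂) (by
    convert hyp using 1
    ext <;> simp [g])
  -- `W` is the pullback of `x` and `a'`, and of `Q` and `f`
  obtain ⟨W, w₁, w₂, sqW⟩ := hT.exists_isPullback a' x hx
  have hw₁ : IsTribeWeakEquivalence fib w₁ := hT.weakEquivalence_baseChange sqW hx hxw
  have sqWQ : IsPullback (sqQ.lift (w₁ ≫ b') (w₂ ≫ f) _) w₂ q₂ f :=
    IsPullback.of_right' (h₁₃ := w₁ ≫ b') (wf ▸ sqW.paste_horiz sq'.flip) sqQ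
  have sqP : IsPullback (sqW.lift w a wa) b _ g :=
    IsPullback.of_right (h₁₂ := w₂) (h₂₂ := q₂) (v₁₃ := f) (by simpa [g] using sq)
      (sqQ.hom_ext (by simp [g, wb]) (by simp [g, sq.w])) sqWQ.flip
  rw [← sqW.lift_fst w a wa]
  exact hT.weakEquivalence_comp (hT.weakEquivalence_baseChange sqP hg hgw) hw₁

end LevelwiseTribe

section LevelwiseTribe

variable {R : Type u} [Category.{v} R] {T : Type u'} [Category.{v'} T]
  {fib : MorphismProperty T}

/-- The diagrams that send every arrow to a weak equivalence, and whose values at the objects of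
`S` are discrete. -/
def IsDiscreteFrame [HasBinaryProducts T] (fib : MorphismProperty T) (S : R → Prop) :
    ObjectProperty (Rᵒᵖ ⥤ T) :=
  fun F => (∀ a, S a → IsTribeDiscrete fib (F.obj (op a))) ∧
    ∀ ⦃x y : Rᵒᵖ⦄ (f : x ⟶ y), IsTribeWeakEquivalence fib (F.map f)

/-- Base changes of levelwise fibrations exist and are computed levelwise. -/
lemma IsTribe.exists_isPullback_functor (hT : IsTribe fib) {X Y Z : Rᵒᵖ ⥤ T} (f : X ⟶ Z)
    (p : Y ⟶ Z) (hp : ∀ a, fib (p.app a)) :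
    ∃ (P : Rᵒᵖ ⥤ T) (p' : P ⟶ X) (f' : P ⟶ Y), IsPullback p' f' f p ∧
      ∀ a, IsPullback (p'.app a) (f'.app a) (f.app a) (p.app a) := by
  have (a : Rᵒᵖ) : HasLimit ((cospan f p).flip.obj a) :=
    have := hT.hasPullback (f.app a) (p.app a) (hp a)
    have : HasLimit (cospan (((cospan f p).flip.obj a).map WalkingCospan.Hom.inl)
      (((cospan f p).flip.obj a).map WalkingCospan.Hom.inr)) := this
    hasLimit_of_iso (diagramIsoCospan ((cospan f p).flip.obj a)).symm
  have : HasPullback f p := inferInstanceAs (HasLimit (cospan f p))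
  have sq := IsPullback.of_hasPullback f p
  exact ⟨_, _, _, sq, fun a => sq.map ((evaluation Rᵒᵖ T).obj a)⟩

variable [HasBinaryProducts T] {S : R → Prop}

/-- A base change of a levelwise fibration of discrete frames is a discrete frame. That it inverts
arrows up to homotopy is only in doubt at arrows with source in `S`, along which the restriction
maps of discrete frames are fibrations, having a discrete target. -/
lemma isDiscreteFrame_of_isPullback (hT : IsTribe fib)
    (hiso : ∀ {a b : R} (f : a ⟶ b), ¬ S a → IsIso f) {P X Y Z : Rᵒᵖ ⥤ T}
    (hX : IsDiscreteFrame fib S X) (hY : IsDiscreteFrame fib S Y) (hZ : IsDiscreteFrame fib S Z)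
    {p' : P ⟶ X} {f' : P ⟶ Y} {f : X ⟶ Z} {p : Y ⟶ Z}
    (sq : ∀ a, IsPullback (p'.app a) (f'.app a) (f.app a) (p.app a)) (hp : ∀ a, fib (p.app a)) :
    IsDiscreteFrame fib S P := by
  refine ⟨fun a ha => (hX.1 a ha).of_isPullback hT (hY.1 a ha) (sq _), fun x y g => ?_⟩
  by_cases hy : S y.unop
  · exact hT.weakEquivalence_pullback (sq x) (sq y) (X.map g) (Y.map g) (Z.map g) (P.map g)
      (f.naturality g).symm (p.naturality g).symm (p'.naturality g) (f'.naturality g)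
      ((hX.1 _ hy).fib_of_target hT _) ((hZ.1 _ hy).fib_of_target hT _)
      ((hY.1 _ hy).fib_lift hT (hp x) _) (hX.2 g) (hY.2 g) (hZ.2 g)
  · have := hiso g.unop hy
    have : IsIso g := (isIso_unop_iff g).1 this
    exact hT.weakEquivalence_of_isIso _

variable (R) in
/-- A choice of a representative of every isomorphism class of objects. -/
lemma exists_representative : ∃ (r : R → R) (_ : ∀ b, b ≅ r b),
    ∀ {b b' : R}, (b ≅ b') → r b = r b' := by
  have h : ∀ b : R, Nonempty (b ≅ (Quotient.mk (isIsomorphicSetoid R) b).out) := fun b =>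
    (Quotient.mk_out (s := isIsomorphicSetoid R) b).map Iso.symm
  exact ⟨_, fun b => (h b).some, fun e => congrArg Quotient.out (Quotient.sound ⟨e⟩)⟩

/-- Levelwise anodyne maps have the left lifting property against levelwise fibrations. -/
lemma exists_lift_functor (hiso : ∀ {a b : R} (f : a ⟶ b), ¬ S a → IsIso f)
    (hext : ∀ {a b : R} (f g : a ⟶ b), ¬ S a → f = g) {A B X Y : Rᵒᵖ ⥤ T}
    (hX : IsDiscreteFrame fib S X) {i : A ⟶ B} {p : X ⟶ Y} (hi : ∀ a, fib.llp (i.app a))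
    (hp : ∀ a, fib (p.app a)) (x : A ⟶ X) (y : B ⟶ Y) (w : x ≫ p = i ≫ y) :
    ∃ l : B ⟶ X, i ≫ l = x ∧ l ≫ p = y := by
  obtain ⟨r, e, hr⟩ := exists_representative R
  have h (a : Rᵒᵖ) := (hi a).exists_lift (hp a) (x.app a) (y.app a) (congr_app w a)
  choose l hl hl' using h
  -- outside `S`, naturality holds because all lifts are transported from the representatives
  let l' (a : Rᵒᵖ) : B.obj a ⟶ X.obj a :=
    B.map (e a.unop).inv.op ≫ l (op (r a.unop)) ≫ X.map (e a.unop).hom.op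
  have fac (a) : i.app a ≫ l' a = x.app a := by
    simp only [l']
    rw [← i.naturality_assoc, reassoc_of% hl]
    exact map_inv_app_map_hom x (e a.unop)
  have fac' (a) : l' a ≫ p.app a = y.app a := by
    simp only [l', Category.assoc]
    rw [p.naturality, reassoc_of% hl']
    exact map_inv_app_map_hom y (e a.unop)
  refine ⟨{ app := l', naturality := fun a b g => ?_ }, ?_, ?_⟩
  · by_cases hb : S b.unop
    · refine (hX.1 _ hb).hom_ext_of_anodyne (hi a) ?_
      rw [← i.naturality_assoc, fac, reassoc_of% fac a, x.naturality]
    · have := hiso g.unop hb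
      have key : ∀ {r r' : R} (h : r = r') (e : a.unop ≅ r) (e' : b.unop ≅ r'),
          B.map g ≫ B.map e'.inv.op ≫ l (op r') ≫ X.map e'.hom.op =
            (B.map e.inv.op ≫ l (op r) ≫ X.map e.hom.op) ≫ X.map g := by
        rintro r _ rfl e e'
        have h₁ : e'.inv ≫ g.unop = e.inv := by
          rw [Iso.inv_comp_eq]
          exact hext _ _ hb
        have h₂ : g.unop ≫ e.hom = e'.hom := hext _ _ hb
        rw [← h₁, ← h₂]
        simp
      exact key (hr (asIso g.unop).symm) (e a.unop) (e b.unop)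
  · ext a
    exact fac a
  · ext a
    exact fac' a

/-- Every map of discrete frames is a levelwise anodyne map followed by a levelwise fibration. A map
with discrete target is already a fibration. Outside `S`, the intermediate diagram is constant on
isomorphism classes. -/
lemma exists_factorization_functor (hT : IsTribe fib)
    (hS : ∀ {a b : R}, S a → (b ≅ a) → S b)
    (hiso : ∀ {a b : R} (f : a ⟶ b), ¬ S a → IsIso f)
    (hext : ∀ {a b : R} (f g : a ⟶ b), ¬ S a → f = g) {X Y : Rᵒᵖ ⥤ T}
    (hX : IsDiscreteFrame fib S X) (hY : IsDiscreteFrame fib S Y) (f : X ⟶ Y) :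
    ∃ (Z : Rᵒᵖ ⥤ T) (i : X ⟶ Z) (p : Z ⟶ Y), IsDiscreteFrame fib S Z ∧
      (∀ a, fib.llp (i.app a)) ∧ (∀ a, fib (p.app a)) ∧ i ≫ p = f := by
  have := hT.hasTerminal
  obtain ⟨r, e, hr⟩ := exists_representative R
  -- at an object of `S`, the identity followed by the given map is a factorization
  have h (b : R) : ∃ (Z : T) (i : X.obj (op b) ⟶ Z) (p : Z ⟶ Y.obj (op b)), fib.llp i ∧ fib p ∧
      i ≫ p = f.app (op b) ∧ (S b → IsIso i) := by
    by_cases hb : S b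
    · exact ⟨_, 𝟙 _, f.app _, fib.llp.id_mem _, (hY.1 b hb).fib_of_target hT _,
        Category.id_comp _, fun _ => inferInstance⟩
    · obtain ⟨Z, i, p, hi, hp, hip⟩ := hT.factorization (f.app (op b))
      exact ⟨Z, i, p, hi, hp, hip, fun h => (hb h).elim⟩
  choose Z i p hi hp hip hiS using h
  let Z' (b : Rᵒᵖ) : T := Z (r b.unop)
  let i' (b : Rᵒᵖ) : X.obj b ⟶ Z' b := X.map (e b.unop).inv.op ≫ i (r b.unop)
  let p' (b : Rᵒᵖ) : Z' b ⟶ Y.obj b := p (r b.unop) ≫ Y.map (e b.unop).hom.op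
  have hip' (b) : i' b ≫ p' b = f.app b := by
    simp only [i', p', Category.assoc, reassoc_of% hip]
    exact map_inv_app_map_hom f (e b.unop)
  have hi' (b) : fib.llp (i' b) :=
    fib.llp.comp_mem _ _ (fib.llp.of_isIso _) (hi _)
  have hp' (b) : fib (p' b) := hT.fib_comp _ _ (hp _) (hT.fib_of_isIso _ inferInstance)
  have hiS' (b : Rᵒᵖ) (hb : S b.unop) : IsIso (i' b) := by
    have := hiS _ (hS hb (e b.unop).symm)
    infer_instance
  have hZS (b : Rᵒᵖ) (hb : S b.unop) : IsTribeDiscrete fib (Z' b) :=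
    have := hiS' b hb
    (hX.1 _ hb).of_iso hT (asIso (i' b)).symm
  have hmap {b b' : Rᵒᵖ} (g : b ⟶ b') : ∃ z : Z' b ⟶ Z' b', i' b ≫ z = X.map g ≫ i' b' ∧
      z ≫ p' b' = p' b ≫ Y.map g ∧ (¬ S b'.unop → ∃ h : Z' b = Z' b', z = eqToHom h) := by
    by_cases hb' : S b'.unop
    · obtain ⟨z, hz, -⟩ := (hi' b).exists_lift (hT.fib_terminalFrom _) (X.map g ≫ i' b')
        (terminal.from _) (Subsingleton.elim _ _)
      refine ⟨z, hz, (hY.1 _ hb').hom_ext_of_anodyne (hi' b) ?_, fun h => (h hb').elim⟩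
      rw [reassoc_of% hz, hip', reassoc_of% hip', f.naturality]
    · have := hiso g.unop hb'
      have key : ∀ {r r' : R} (h : r = r') (e : b.unop ≅ r) (e' : b'.unop ≅ r'),
          (X.map e.inv.op ≫ i r) ≫ eqToHom (congrArg Z h) = X.map g ≫ X.map e'.inv.op ≫ i r' ∧
          eqToHom (congrArg Z h) ≫ p r' ≫ Y.map e'.hom.op =
            (p r ≫ Y.map e.hom.op) ≫ Y.map g := by
        rintro r _ rfl e e'
        have h₁ : e'.inv ≫ g.unop = e.inv := by
          rw [Iso.inv_comp_eq]
          exact hext _ _ hb'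
        have h₂ : g.unop ≫ e.hom = e'.hom := hext _ _ hb'
        rw [← h₁, ← h₂]
        simp
      have h := hr (asIso g.unop).symm
      obtain ⟨h₁, h₂⟩ := key h (e b.unop) (e b'.unop)
      exact ⟨eqToHom (congrArg Z h), h₁, h₂, fun _ => ⟨congrArg Z h, rfl⟩⟩
  choose z hz hz' hze using @hmap
  have z_id (b : Rᵒᵖ) : z (𝟙 b) = 𝟙 (Z' b) := by
    by_cases hb : S b.unop
    · refine (hZS b hb).hom_ext_of_anodyne (hi' b) ?_
      rw [hz]
      simp
    · obtain ⟨_, h⟩ := hze (𝟙 b) hb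
      rw [h, eqToHom_refl]
  have z_comp {b b' b'' : Rᵒᵖ} (g : b ⟶ b') (g' : b' ⟶ b'') : z (g ≫ g') = z g ≫ z g' := by
    by_cases hb : S b''.unop
    · refine (hZS b'' hb).hom_ext_of_anodyne (hi' b) ?_
      rw [hz, reassoc_of% hz g, hz]
      simp
    · have := hiso g'.unop hb
      obtain ⟨_, h⟩ := hze (g ≫ g') hb
      obtain ⟨_, h₁⟩ := hze g' hb
      obtain ⟨_, h₂⟩ := hze g fun h => hb (hS h (asIso g'.unop))
      rw [h, h₁, h₂, eqToHom_trans]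
  refine ⟨{ obj := Z', map := z, map_id := z_id, map_comp := z_comp },
    { app := i', naturality := fun b b' g => (hz g).symm },
    { app := p', naturality := fun b b' g => hz' g },
    ⟨fun a ha => hZS (op a) ha, fun b b' g => ?_⟩, hi', hp', ?_⟩
  · refine hT.weakEquivalence_of_comp_left (hT.weakEquivalence_of_anodyne (hi' b)) ?_
    change IsTribeWeakEquivalence fib (i' b ≫ z g)
    rw [hz]
    exact hT.weakEquivalence_comp (hX.2 g) (hT.weakEquivalence_of_anodyne (hi' b'))
  · ext b
    exact hip' b

end LevelwiseTribe

section LevelwiseTribe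

variable {R : Type u} [Category.{v} R] {T : Type u'} [Category.{v'} T]
  {fib : MorphismProperty T} [HasBinaryProducts T] {S : R → Prop}

/-- The constant diagram at a terminal object is terminal among discrete frames. -/
lemma exists_isTerminal_discreteFrame (hT : IsTribe fib) :
    ∃ (E : (IsDiscreteFrame fib S).FullSubcategory) (_ : IsTerminal E),
      ∀ a, Nonempty (IsTerminal (E.obj.obj a)) := by
  have := hT.hasTerminal
  let F : Rᵒᵖ ⥤ T := (Functor.const Rᵒᵖ).obj (⊤_ T)
  have hF : IsDiscreteFrame fib S F := by
    refine ⟨fun a _ => ?_, fun x y f => hT.weakEquivalence_of_isIso (𝟙 (⊤_ T))⟩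
    have : Mono (terminal.from ((⊤_ T) ⨯ (⊤_ T))) :=
      ⟨fun g h _ => prod.hom_ext (Subsingleton.elim _ _) (Subsingleton.elim _ _)⟩
    refine hT.fib_of_mono _ (terminal.from ((⊤_ T) ⨯ (⊤_ T))) ?_
    rw [Subsingleton.elim (_ ≫ _) (terminal.from _)]
    exact hT.fib_terminalFrom _
  refine ⟨⟨F, hF⟩, IsTerminal.ofUniqueHom
    (fun X => ObjectProperty.homMk { app := fun a => terminal.from _ }) (fun X m => ?_),
    fun a => ⟨terminalIsTerminal⟩⟩
  ext a
  exact Subsingleton.elim (α := _ ⟶ ⊤_ T) _ _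

/-- Base changes of levelwise fibrations of discrete frames exist. -/
lemma exists_isPullback_discreteFrame (hT : IsTribe fib)
    (hiso : ∀ {a b : R} (f : a ⟶ b), ¬ S a → IsIso f)
    {X Y Z : (IsDiscreteFrame fib S).FullSubcategory} (f : X ⟶ Z) (p : Y ⟶ Z)
    (hp : ∀ a, fib (p.hom.app a)) :
    ∃ (P : (IsDiscreteFrame fib S).FullSubcategory) (p' : P ⟶ X) (f' : P ⟶ Y),
      IsPullback p' f' f p ∧
      ∀ a, IsPullback (p'.hom.app a) (f'.hom.app a) (f.hom.app a) (p.hom.app a) := by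
  obtain ⟨P, p', f', sq, sq'⟩ := hT.exists_isPullback_functor f.hom p.hom hp
  have hP : IsDiscreteFrame fib S P :=
    isDiscreteFrame_of_isPullback hT hiso X.property Y.property Z.property sq' hp
  refine ⟨⟨P, hP⟩, ObjectProperty.homMk p', ObjectProperty.homMk f', ?_, sq'⟩
  exact IsPullback.of_map (IsDiscreteFrame fib S).ι (ObjectProperty.hom_ext _ sq.w) sq

/-- Base changes of levelwise fibrations of discrete frames are computed levelwise. -/
lemma isPullback_app_discreteFrame (hT : IsTribe fib)
    (hiso : ∀ {a b : R} (f : a ⟶ b), ¬ S a → IsIso f)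
    {P X Y Z : (IsDiscreteFrame fib S).FullSubcategory} {p' : P ⟶ X} {f' : P ⟶ Y} {f : X ⟶ Z}
    {p : Y ⟶ Z} (sq : IsPullback p' f' f p) (hp : ∀ a, fib (p.hom.app a)) (a : Rᵒᵖ) :
    IsPullback (p'.hom.app a) (f'.hom.app a) (f.hom.app a) (p.hom.app a) := by
  obtain ⟨P₀, p₀, f₀, sq₀, h₀⟩ := exists_isPullback_discreteFrame hT hiso f p hp
  let e := ((IsDiscreteFrame fib S).ι ⋙ (evaluation Rᵒᵖ T).obj a).mapIso
    (sq₀.isoIsPullback _ _ sq)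
  have h₁ : e.hom ≫ p'.hom.app a = p₀.hom.app a :=
    congrArg (fun t => t.hom.app a) (sq₀.isoIsPullback_hom_fst _ _ sq)
  have h₂ : e.hom ≫ f'.hom.app a = f₀.hom.app a :=
    congrArg (fun t => t.hom.app a) (sq₀.isoIsPullback_hom_snd _ _ sq)
  exact (h₀ a).of_iso e (Iso.refl _) (Iso.refl _) (Iso.refl _) (by simp [h₁]) (by simp [h₂])
    (by simp) (by simp)

/-- The discrete frames form a tribe, with the levelwise fibrations as fibrations. -/
theorem isTribe_discreteFrame (hT : IsTribe fib)
    (hS : ∀ {a b : R}, S a → (b ≅ a) → S b)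
    (hiso : ∀ {a b : R} (f : a ⟶ b), ¬ S a → IsIso f)
    (hext : ∀ {a b : R} (f g : a ⟶ b), ¬ S a → f = g)
    (W : MorphismProperty (IsDiscreteFrame fib S).FullSubcategory)
    (hW : ∀ {X Y} (m : X ⟶ Y), W m ↔ ∀ a, fib (m.hom.app a)) : IsTribe W := by
  have isIso_app {X Y : (IsDiscreteFrame fib S).FullSubcategory} (m : X ⟶ Y) [IsIso m] (a : Rᵒᵖ) :
      IsIso (m.hom.app a) :=
    inferInstanceAs (IsIso (((IsDiscreteFrame fib S).ι ⋙ (evaluation Rᵒᵖ T).obj a).map m))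
  have llp_of_app {A B : (IsDiscreteFrame fib S).FullSubcategory} (i : A ⟶ B)
      (hi : ∀ a, fib.llp (i.hom.app a)) : W.llp i := by
    refine fun X Y p hp => ⟨fun {x y} sq => ?_⟩
    obtain ⟨l, hl, hl'⟩ := exists_lift_functor hiso hext X.property hi ((hW p).1 hp) x.hom y.hom
      (congrArg (·.hom) sq.w)
    exact ⟨⟨ObjectProperty.homMk l, ObjectProperty.hom_ext _ hl, ObjectProperty.hom_ext _ hl'⟩⟩
  have factorization {X Y : (IsDiscreteFrame fib S).FullSubcategory} (f : X ⟶ Y) :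
      ∃ (Z : (IsDiscreteFrame fib S).FullSubcategory) (i : X ⟶ Z) (p : Z ⟶ Y),
        (∀ a, fib.llp (i.hom.app a)) ∧ W p ∧ i ≫ p = f := by
    obtain ⟨Z, i, p, hZ, hi, hp, hip⟩ :=
      exists_factorization_functor hT hS hiso hext X.property Y.property f.hom
    exact ⟨⟨Z, hZ⟩, ObjectProperty.homMk i, ObjectProperty.homMk p, hi, (hW _).2 hp,
      ObjectProperty.hom_ext _ hip⟩
  -- an anodyne map is a retract of the levelwise anodyne part of its factorization
  have app_of_llp {A B : (IsDiscreteFrame fib S).FullSubcategory} (i : A ⟶ B) (hi : W.llp i)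
      (a : Rᵒᵖ) : fib.llp (i.hom.app a) := by
    obtain ⟨Z, j, q, hj, hq, hjq⟩ := factorization i
    obtain ⟨s, hs, hsq⟩ := hi.exists_lift hq j (𝟙 B) (by rw [hjq, Category.comp_id])
    have h₁ : j.hom.app a ≫ q.hom.app a = i.hom.app a := congrArg (fun t => t.hom.app a) hjq
    have h₂ : i.hom.app a ≫ s.hom.app a = j.hom.app a := congrArg (fun t => t.hom.app a) hs
    have h₃ : s.hom.app a ≫ q.hom.app a = 𝟙 _ := congrArg (fun t => t.hom.app a) hsq
    refine fun X Y p hp => ⟨fun {x y} sq => ?_⟩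
    obtain ⟨l, hl, hl'⟩ := (hj a).exists_lift hp x (q.hom.app a ≫ y)
      (by rw [reassoc_of% h₁, sq.w])
    exact ⟨⟨s.hom.app a ≫ l, by rw [reassoc_of% h₂, hl], by
      rw [Category.assoc, hl', reassoc_of% h₃]⟩⟩
  obtain ⟨E, hE, hE'⟩ := exists_isTerminal_discreteFrame (S := S) hT
  refine
    { hasTerminal := hE.hasTerminal
      fib_toTerminal := fun {X Z} hZ => (hW _).2 fun a => ?_
      fib_of_isIso := fun f _ => (hW f).2 fun a => hT.fib_of_isIso _ (isIso_app f a)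
      fib_comp := fun f g hf hg => (hW _).2 fun a =>
        hT.fib_comp _ _ ((hW f).1 hf a) ((hW g).1 hg a)
      hasPullback := fun f p hp => ?_
      fib_baseChange := fun sq hp => (hW _).2 fun a => hT.fib_baseChange
        (isPullback_app_discreteFrame hT hiso sq ((hW _).1 hp) a) ((hW _).1 hp a)
      factorization := fun f => ?_
      anodyne_baseChange := fun {P X Y Z i' q' q i} sq hq hi => llp_of_app _ fun a => ?_ }
  · obtain ⟨h⟩ := hE' a
    have hZa : IsTerminal (Z.obj.obj a) := h.ofIso
      (((IsDiscreteFrame fib S).ι ⋙ (evaluation Rᵒᵖ T).obj a).mapIso (hE.uniqueUpToIso hZ))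
    rw [hZa.hom_ext ((hZ.from X).hom.app a) (hZa.from _)]
    exact hT.fib_toTerminal hZa
  · obtain ⟨P, p', f', sq, -⟩ := exists_isPullback_discreteFrame hT hiso f p ((hW p).1 hp)
    exact sq.hasPullback
  · obtain ⟨Z, i, p, hi, hp, hip⟩ := factorization f
    exact ⟨Z, i, p, llp_of_app i hi, hp, hip⟩
  · exact hT.anodyne_baseChange
      ((isPullback_app_discreteFrame hT hiso sq.flip ((hW _).1 hq) a).flip)
      ((hW _).1 hq a) (app_of_llp _ hi a)

end LevelwiseTribe

theorem mainTheorem3 {R₀ : Type*} [Category* R₀] {R : Type*} [Category* R]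
    {T : Type*} [Category* T]
    (hR₀ : IsDirectCategory R₀) (hR : IsGeneralizedDirectCategory R)
    (c : R₀ ⥤ R) (hc : c.ReflectsIsomorphisms) (hlift : LiftsArrowsUpToIso c)
    (fib : MorphismProperty T) (hT : IsTribe fib) :
    IsTribe (frameFibrations c fib) := by
  have := hT.hasBinaryProducts
  have hP : IsFrame c fib = IsDiscreteFrame fib (IsSpecial c) := by
    ext F
    exact ⟨fun hF => ⟨fun a ha => hF.isTribeDiscrete hT hR₀ hR hc ha, hF.2⟩,
      fun hF => isFrame_of_isTribeDiscrete hT hR₀ hR hc hF.1 hF.2⟩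
  have key : ∀ (P : ObjectProperty (Rᵒᵖ ⥤ T)) (_ : P = IsDiscreteFrame fib (IsSpecial c))
      (W : MorphismProperty P.FullSubcategory)
      (_ : ∀ {X Y} (m : X ⟶ Y), W m ↔ ∀ a, fib (m.hom.app a)), IsTribe W := by
    rintro _ rfl W hW
    exact isTribe_discreteFrame hT (fun ha e => ha.of_iso e)
      (fun f ha => isIso_of_not_isSpecial hlift ha f)
      (fun f g ha => hom_ext_of_not_isSpecial hR₀ hc hlift ha f g) W hW
  exact key _ hP _ fun {X Y} m =>
    pFibrations_iff hT hR₀ hR hc hlift X.property Y.property m.hom
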